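/- Let $m\ge 1$, let $\mathbf A$ be a real $m\times n$ matrix, $\mathbf b\in\mathbb R^m$, and let $f:\mathbb R^n\to\mathbb R$ be twice continuously differentiable and strongly convex. Consider the program $\min f(\mathbf x)$ subject to $\mathbf A\mathbf x\le\mathbf b$, with constraint functions $g_k(\mathbf x)=(\mathbf A\mathbf x)_k-b_k$, and assume that it has an optimal solution $\mathbf x^\ast$. Let $q(\boldsymbol\lambda)=\min_{\mathbf x\in\mathbb R^n}\{f(\mathbf x)+\sum_k\lambda_kg_k(\mathbf x)\}$, $\boldsymbol\lambda\in\mathbb R^m_+$, be the dual function. Consider the following conditions (norms are Euclidean). (A1) $f$ is strongly convex with some modulus $\alpha>0$, and every $g_k$ is Lipschitz with some modulus $\beta>0$. (A2) There is a Lagrange multiplier, i.e. a $\boldsymbol\lambda^\ast\in\mathbb R^m_+$ with $q(\boldsymbol\lambda^\ast)=\min\{f(\mathbf x):\mathbf A\mathbf x\le\mathbf b\}$. (A3) $q$ is differentiable on $\mathbb R^m_+$, with a gradient that is Lipschitz on $\mathbb R^m_+$ with some modulus $\gamma>0$. (A4) For every Lagrange multiplier $\boldsymbol\lambda^\ast$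 there are $D_q,L_q>0$ with $q(\boldsymbol\lambda^\ast)\ge q(\boldsymbol\lambda)+L_q\|\boldsymbol\lambda-\boldsymbol\lambda^\ast\|^2$ for all $\boldsymbol\lambda\in\mathbb R^m_+$ with $\|\boldsymbol\lambda-\boldsymbol\lambda^\ast\|\le D_q$. (A5) For every Lagrange multiplier $\boldsymbol\lambda^\ast$ there are $D_c,L_c>0$ such that $q$ is strongly concave with modulus $L_c$ on $\{\boldsymbol\lambda\in\mathbb R^m_+:\|\boldsymbol\lambda-\boldsymbol\lambda^\ast\|\le D_c\}$. The drift-plus-penalty algorithm with parameter $V>0$ and initial values $Q_k(0)\ge0$ computes, for $t=0,1,2,\dots$, $$\mathbf x(t)=\operatorname*{argmin}_{\mathbf x\in\mathbb R^n}\Big[Vf(\mathbf x)+\sum_{k}Q_k(t)g_k(\mathbf x)\Big],\qquad Q_k(t+1)=\max\{Q_k(t)+g_k(\mathbf x(t)),0\};$$ its shifted running averages are $\overline{\mathbf x}(t)=\frac{2}{t}\sum_{\tau=t/2}^{t-1}\mathbf x(\tau)$ for even $t\ge2$ and $\overline{\mathbf x}(t)=\overline{\mathbf x}(t-1)$ for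 odd $t$, where $\overline{\mathbf x}(0)$ is arbitrary. A sequence $\mathbf y(t)$ has error decaying like $O(r(t))$ if for some constant $C$ and all large $t$ one has $f(\mathbf y(t))\le f(\mathbf x^\ast)+Cr(t)$ and $g_k(\mathbf y(t))\le Cr(t)$ for all $k$; it has convergence time $O(h(\epsilon))$ if for some constant $C$ and all sufficiently small $\epsilon>0$, every $\mathbf y(t)$ with $t\ge Ch(\epsilon)$ is $\epsilon$-optimal, i.e. $f(\mathbf y(t))\le f(\mathbf x^\ast)+\epsilon$ and $g_k(\mathbf y(t))\le\epsilon$ for all $k$. Then the minimum defining $q(\boldsymbol\lambda)$ is attained for every $\boldsymbol\lambda\in\mathbb R^m_+$, the algorithm can be executed for all $V>0$ and $\mathbf Q(0)\ge\mathbf 0$, and the following hold. 1. Let $l$ be the number of constraints active at $\mathbf x^\ast$ and $\mathbf A'$ the $l\times n$ submatrix of the corresponding rows of $\mathbf A$. If $\operatorname{rank}(\mathbf A')=l$, then (A1)–(A4) hold. Moreover, for all moduli $\alpha,\beta,\gamma$ as in (A1) and (A3), all $V\ge\max\{m\beta^2/\alpha,\gamma\}$ and all $\mathbf Q(0)\ge\mathbf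 0$, the shifted running averages $\overline{\mathbf x}(t)$ have error decaying like $O(1/t^{3/2})$ and convergence time $O(1/\epsilon^{2/3})$. 2. If $\operatorname{rank}(\mathbf A)=m$, then (A1)–(A3) and (A5) hold. Moreover, for all moduli $\alpha,\beta,\gamma$ as in (A1) and (A3), all $V\ge\max\{m\beta^2/\alpha,\gamma\}$ and all $\mathbf Q(0)\ge\mathbf 0$, both the iterates $\mathbf x(t)$ themselves and the shifted running averages $\overline{\mathbf x}(t)$ have error decaying like $O\big(\frac1t(1-\frac{L_c}{V})^{t/4}\big)$, for every $L_c$ as in (A5), and convergence time $O(\log(1/\epsilon))$. -/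

import Mathlib

namespace DPP

open Set Filter Topology
open scoped Matrix

/-- `ℝ^d` with the Euclidean norm. -/
abbrev E (d : ℕ) : Type := EuclideanSpace ℝ (Fin d)

/-- The nonnegative orthant `ℝ^d_+`. -/
def orthant (d : ℕ) : Set (E d) := {v | ∀ k, 0 ≤ v k}

/-! ### The program `min f(x)` subject to `g_k(x) ≤ 0` for all `k`, `x ∈ X` -/

/-- The feasible set. -/
def feasible {m n : ℕ} (X : Set (E n)) (g : Fin m → E n → ℝ) : Set (E n) :=
  {x | x ∈ X ∧ ∀ k, g k x ≤ 0}

/-- `x` is an optimal solution of the program. -/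
def IsOptimal {m n : ℕ} (X : Set (E n)) (f : E n → ℝ) (g : Fin m → E n → ℝ) (x : E n) : Prop :=
  x ∈ feasible X g ∧ IsMinOn f (feasible X g) x

/-- `x` is an `ε`-optimal solution, where `xs` is an optimal solution. -/
def IsEpsOptimal {m n : ℕ} (X : Set (E n)) (f : E n → ℝ) (g : Fin m → E n → ℝ) (xs : E n)
    (ε : ℝ) (x : E n) : Prop :=
  x ∈ X ∧ f x ≤ f xs + ε ∧ ∀ k, g k x ≤ ε

/-- The Lagrangian `f(x) + ∑ λ_k g_k(x)`. -/
def lagrangian {m n : ℕ} (f : E n → ℝ) (g : Fin m → E n → ℝ) (lam : E m) (x : E n) : ℝ :=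
  f x + ∑ k, lam k * g k x

/-- The Lagrangian dual function `q(λ)`, the minimum of the Lagrangian over `X`. -/
noncomputable def dual {m n : ℕ} (X : Set (E n)) (f : E n → ℝ) (g : Fin m → E n → ℝ)
    (lam : E m) : ℝ :=
  sInf (lagrangian f g lam '' X)

/-- The minimum that defines the dual function is attained for every `λ ∈ ℝ^m_+`. -/
def DualAttained {m n : ℕ} (X : Set (E n)) (f : E n → ℝ) (g : Fin m → E n → ℝ) : Prop :=
  ∀ lam ∈ orthant m, IsLeast (lagrangian f g lam '' X) (dual X f g lam)

/-- `λ ≥ 0` is a Lagrange multiplier attaining strong duality: `q(λ)` is the optimal value. -/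
def IsLagrangeMultiplier {m n : ℕ} (X : Set (E n)) (f : E n → ℝ) (g : Fin m → E n → ℝ)
    (lam : E m) : Prop :=
  lam ∈ orthant m ∧ IsLeast (f '' feasible X g) (dual X f g lam)

/-! ### The assumptions on the program -/

/-- `f` is strongly convex on `X` with modulus `α > 0` and every `g_k` is Lipschitz continuous on
`X` with modulus `β > 0`. -/
def StronglyConvexProblem {m n : ℕ} (X : Set (E n)) (f : E n → ℝ) (g : Fin m → E n → ℝ)
    (α β : ℝ) : Prop :=
  0 < α ∧ StrongConvexOn X α f ∧
    0 < β ∧ ∀ k, ∀ x ∈ X, ∀ y ∈ X, |g k y - g k x| ≤ β * ‖y - x‖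

/-- Strong duality holds. -/
def StrongDuality {m n : ℕ} (X : Set (E n)) (f : E n → ℝ) (g : Fin m → E n → ℝ) : Prop :=
  ∃ lam, IsLagrangeMultiplier X f g lam

/-- `F` is differentiable on `S` with a gradient that is Lipschitz continuous on `S` with modulus
`L > 0` (so `F` is continuously differentiable on `S`). The gradient is taken relative to `S`, so
that it makes sense at the boundary points of the orthant; it is unique there. -/
def IsSmoothOn {d : ℕ} (S : Set (E d)) (F : E d → ℝ) (L : ℝ) : Prop :=
  0 < L ∧ ∃ G : E d → E d, (∀ x ∈ S, HasGradientWithinAt F (G x) S x) ∧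
    ∀ x ∈ S, ∀ y ∈ S, ‖G y - G x‖ ≤ L * ‖y - x‖

/-- The dual function is smooth on `ℝ^m_+` with modulus `γ`. -/
def SmoothDual {m n : ℕ} (X : Set (E n)) (f : E n → ℝ) (g : Fin m → E n → ℝ) (γ : ℝ) : Prop :=
  IsSmoothOn (orthant m) (dual X f g) γ

/-- The dual function is locally quadratic at `lams`, with radius `D > 0` and constant `L > 0`. -/
def LocallyQuadraticDualAt {m n : ℕ} (X : Set (E n)) (f : E n → ℝ) (g : Fin m → E n → ℝ)
    (lams : E m) (D L : ℝ) : Prop :=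
  0 < D ∧ 0 < L ∧ ∀ lam ∈ orthant m, ‖lam - lams‖ ≤ D →
    dual X f g lam + L * ‖lam - lams‖ ^ 2 ≤ dual X f g lams

/-- The dual function is strongly concave with modulus `L > 0` on the part of the orthant within
distance `D > 0` of `lams`. -/
def LocallyStronglyConcaveDualAt {m n : ℕ} (X : Set (E n)) (f : E n → ℝ) (g : Fin m → E n → ℝ)
    (lams : E m) (D L : ℝ) : Prop :=
  0 < D ∧ 0 < L ∧
    StrongConcaveOn {lam | lam ∈ orthant m ∧ ‖lam - lams‖ ≤ D} L (dual X f g)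

/-! ### The algorithm -/

/-- A run of the drift-plus-penalty algorithm with shifted running averages with parameter `V`:
`x t` are the primal iterates, `Q t` the virtual queues, and `xbar t` the shifted running averages
(the value `xbar 0` is arbitrary). The pair `x`, `Q` alone is a run of the drift-plus-penalty
algorithm without running averages. -/
structure IsRun {m n : ℕ} (X : Set (E n)) (f : E n → ℝ) (g : Fin m → E n → ℝ) (V : ℝ)
    (x : ℕ → E n) (Q : ℕ → E m) (xbar : ℕ → E n) : Prop where
  V_pos : 0 < V
  init : Q 0 ∈ orthant m
  mem : ∀ t, x t ∈ X
  argmin : ∀ t, IsMinOn (fun y => V * f y + ∑ k, Q t k * g k y) X (x t)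
  queue : ∀ t k, Q (t + 1) k = max (Q t k + g k (x t)) 0
  avg_even : ∀ t, Even (t + 1) →
    xbar (t + 1) = (((t + 1 : ℕ) : ℝ) / 2)⁻¹ • ∑ τ ∈ Finset.Icc ((t + 1) / 2) t, x τ
  avg_odd : ∀ t, Odd (t + 1) → xbar (t + 1) = xbar t

/-- The algorithm can be executed with every parameter `V > 0` and all initial queues. -/
def RunsExist {m n : ℕ} (X : Set (E n)) (f : E n → ℝ) (g : Fin m → E n → ℝ) : Prop :=
  ∀ V : ℝ, 0 < V → ∀ Q₀ ∈ orthant m, ∃ x Q xbar, IsRun X f g V x Q xbar ∧ Q 0 = Q₀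

/-- The objective and constraint errors of the sequence `y` decay like `O(r(t))`. -/
def ErrorDecaysLike {m n : ℕ} (f : E n → ℝ) (g : Fin m → E n → ℝ) (xs : E n) (y : ℕ → E n)
    (r : ℕ → ℝ) : Prop :=
  ∃ C : ℝ, 0 < C ∧ ∀ᶠ t : ℕ in atTop, f (y t) ≤ f xs + C * r t ∧ ∀ k, g k (y t) ≤ C * r t

/-- The convergence time of the sequence `y` is `O(h(ε))` as `ε → 0`: there is a constant `C`
such that, for all small `ε > 0`, every `y t` with `t ≥ C h(ε)` is `ε`-optimal. -/
def HasConvergenceTime {m n : ℕ} (X : Set (E n)) (f : E n → ℝ) (g : Fin m → E n → ℝ) (xs : E n)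
    (y : ℕ → E n) (h : ℝ → ℝ) : Prop :=
  ∃ C : ℝ, 0 < C ∧ ∀ᶠ ε : ℝ in 𝓝[>] 0, ∀ t : ℕ, C * h ε ≤ t → IsEpsOptimal X f g xs ε (y t)

/-! ### Linear constraints `A x ≤ b` -/

/-- The constraint functions `g_k(x) = (A x)_k - b_k`. -/
def linCon {m n : ℕ} (A : Matrix (Fin m) (Fin n) ℝ) (b : Fin m → ℝ) (k : Fin m) (x : E n) : ℝ :=
  (A *ᵥ x.ofLp) k - b k

/-- The constraints that are active at `x`. -/
def activeSet {m n : ℕ} (A : Matrix (Fin m) (Fin n) ℝ) (b : Fin m → ℝ) (x : E n) :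
    Set (Fin m) :=
  {k | (A *ᵥ x.ofLp) k = b k}

/-- The submatrix of the rows of `A` whose constraints are active at `x`. -/
def activeSubmatrix {m n : ℕ} (A : Matrix (Fin m) (Fin n) ℝ) (b : Fin m → ℝ) (x : E n) :
    Matrix (activeSet A b x) (Fin n) ℝ :=
  A.submatrix (fun k => (k : Fin m)) id

end DPP

open Set Filter Topology
open scoped Matrix RealInnerProductSpace

/-! ### Strongly convex functions -/

/-! The scaled queues `λ(t) = Q(t)/V` perform projected gradient ascent with step `1/V` on the dual
function `q`: the iterate `x(t)` minimizes the Lagrangian at `λ(t)`, and the constraint values there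
form a supergradient of `q` (`IsDualMin.dual_le`). Since `‖A v‖² ≤ m β² ‖v‖²`, the condition `V ≥ m
β² / α` makes `q` at least as flat as a quadratic of curvature `V` (`IsDualMin.le_dual`), so that
each step lowers the squared distance to a multiplier `λ*` by at least `2/V` times the dual gap at
the new point (`projected_step_dual`).

Curvature of `q` comes from stationarity, `∇f(x) = -Aᵀλ`. A right inverse of the active rows
recovers the active part of `λ - λ*` from `∇f(x) - ∇f(x*)`, up to the inactive part
(`IsDualMin.norm_restr_le`). As `∇f` is locally Lipschitz, `‖x - x*‖` and the inactive part together
control `λ - λ*`. Strong convexity charges `q` for the former and the slack of the inactive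
constraints charges it for the latter, which gives quadratic growth. When all rows are independent
there is no inactive part, and `q` is locally strongly concave.

Quadratic growth turns the step inequality into an eventual geometric contraction of the queues
(`IsRun.eventually_contract`); part 1 is thus proved with a geometric rate, which is more than it
asks. Strong concavity sharpens the factor for squared distances to `1 - L_c/V`
(`IsRun.eventually_contract_of_stronglyConcave`). Minimizers depend on `λ` in a Lipschitz way, so
the rate passes to `x(t)`. Averaging from `t/2` on halves the exponent and contributes the factor
`1/t` (`IsRun.rates`). -/

theorem le_of_forall_one_sub_mul_le {a c : ℝ} (h : ∀ s : ℝ, 0 < s → s < 1 → (1 - s) * a ≤ c) :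
    a ≤ c := by
  have ht : Tendsto (fun s : ℝ => (1 - s) * a) (𝓝[>] 0) (𝓝 ((1 - 0) * a)) :=
    (Continuous.tendsto (by fun_prop) 0).mono_left nhdsWithin_le_nhds
  rw [sub_zero, one_mul] at ht
  refine le_of_tendsto ht ?_
  filter_upwards [Ioo_mem_nhdsGT (zero_lt_one (α := ℝ))] with s hs using h s hs.1 hs.2

section StrongConvex

variable {F : Type*} [NormedAddCommGroup F] [NormedSpace ℝ F]

/-- Divide the strong convexity inequality on the segment by `s` and let `s` decrease to `0`. -/
theorem StrongConvexOn.add_le_of_hasFDerivAt {h : F → ℝ} {α : ℝ} (hc : StrongConvexOn univ α h)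
    {x : F} {h' : F →L[ℝ] ℝ} (hd : HasFDerivAt h h' x) (y : F) :
    h x + h' (y - x) + α / 2 * ‖y - x‖ ^ 2 ≤ h y := by
  have hline : HasDerivAt (fun s : ℝ => h (x + s • (y - x))) (h' (y - x)) 0 := by
    have h1 : HasDerivAt (fun s : ℝ => x + s • (y - x)) (y - x) 0 := by
      simpa using ((hasDerivAt_id (0 : ℝ)).smul_const (y - x)).const_add x
    have h2 : HasFDerivAt h h' (x + (0 : ℝ) • (y - x)) := by simpa using hd
    exact h2.comp_hasDerivAt 0 h1
  have ht := hline.tendsto_slope_zero_right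
  have ht2 : Tendsto (fun s : ℝ => h y - h x - (1 - s) * (α / 2 * ‖y - x‖ ^ 2)) (𝓝[>] 0)
      (𝓝 (h y - h x - (1 - 0) * (α / 2 * ‖y - x‖ ^ 2))) :=
    (Continuous.tendsto (by fun_prop) 0).mono_left nhdsWithin_le_nhds
  have key : h' (y - x) ≤ h y - h x - (1 - 0) * (α / 2 * ‖y - x‖ ^ 2) := by
    refine le_of_tendsto_of_tendsto ht ht2 ?_
    filter_upwards [Ioo_mem_nhdsGT (zero_lt_one (α := ℝ))] with s hs
    have hs0 : 0 < s := hs.1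
    have := hc.2 (mem_univ x) (mem_univ y) (sub_nonneg.2 hs.2.le) hs0.le (by ring)
    have e : (1 - s) • x + s • y = x + s • (y - x) := by module
    rw [e, norm_sub_rev x y] at this
    simp only [smul_eq_mul, zero_add, zero_smul, add_zero] at this ⊢
    rw [inv_mul_le_iff₀ hs0]
    linarith
  linarith

theorem StrongConvexOn.add_affine {h : F → ℝ} {α : ℝ} (hc : StrongConvexOn univ α h) {l : F → ℝ}
    (hl : ∀ x y (a c : ℝ), a + c = 1 → l (a • x + c • y) = a * l x + c * l y) :
    StrongConvexOn univ α (fun x => h x + l x) := by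
  refine ⟨convex_univ, fun x _ y _ a c ha hc' hac => ?_⟩
  have := hc.2 (mem_univ x) (mem_univ y) ha hc' hac
  simp only [smul_eq_mul] at this ⊢
  rw [hl x y a c hac]
  linarith

/-- The first-order bound at `0` grows quadratically, so `h` is coercive. -/
theorem StrongConvexOn.exists_isMinOn [ProperSpace F] {h : F → ℝ} {α : ℝ} (hα : 0 < α)
    (hc : StrongConvexOn univ α h) (hd : Differentiable ℝ h) : ∃ x, IsMinOn h univ x := by
  have hbound : ∀ y, h 0 + ‖y‖ * (α / 2 * ‖y‖ - ‖fderiv ℝ h 0‖) ≤ h y := fun y => by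
    have h1 := hc.add_le_of_hasFDerivAt (hd 0).hasFDerivAt y
    have h2 := (fderiv ℝ h 0).le_opNorm y
    rw [Real.norm_eq_abs] at h2
    have h3 := neg_abs_le (fderiv ℝ h 0 y)
    rw [sub_zero] at h1
    nlinarith
  have ht : Tendsto (fun y : F => h 0 + ‖y‖ * (α / 2 * ‖y‖ - ‖fderiv ℝ h 0‖)) (cocompact F)
      atTop := by
    have hr : Tendsto (fun r : ℝ => h 0 + r * (α / 2 * r - ‖fderiv ℝ h 0‖)) atTop atTop := by
      refine tendsto_atTop_add_const_left _ _ (tendsto_id.atTop_mul_atTop₀ ?_)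
      exact tendsto_atTop_add_const_right _ _ (tendsto_id.const_mul_atTop (by positivity))
    exact hr.comp tendsto_norm_cocompact_atTop
  obtain ⟨x, hx⟩ := hd.continuous.exists_forall_le (tendsto_atTop_mono hbound ht)
  exact ⟨x, fun y _ => hx y⟩

end StrongConvex

namespace DPP

variable {m n : ℕ} {f : E n → ℝ} {A : Matrix (Fin m) (Fin n) ℝ} {b : Fin m → ℝ} {xs : E n}

/-! ### The constraint map -/

/-- The linear map `x ↦ A x` between Euclidean spaces. -/
noncomputable def conMap (A : Matrix (Fin m) (Fin n) ℝ) : E n →L[ℝ] E m :=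
  (Matrix.toEuclideanLin A).toContinuousLinearMap

/-- The vector of the values of the constraint functions `A x - b`. -/
noncomputable def conVec (A : Matrix (Fin m) (Fin n) ℝ) (b : Fin m → ℝ) (x : E n) : E m :=
  WithLp.toLp 2 fun k => linCon A b k x

theorem conVec_apply (x : E n) (k : Fin m) : conVec A b x k = linCon A b k x := rfl

theorem conVec_eq (x : E n) : conVec A b x = conMap A x - WithLp.toLp 2 b := rfl

theorem conVec_sub (x y : E n) : conVec A b x - conVec A b y = conMap A (x - y) := by
  rw [conVec_eq, conVec_eq, map_sub]; abel

theorem inner_eq_sum (u v : E m) : ⟪u, v⟫ = ∑ k, u k * v k := by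
  rw [PiLp.inner_apply]
  exact Finset.sum_congr rfl fun k _ => by simp [mul_comm]

theorem lagrangian_eq (lam : E m) (x : E n) :
    lagrangian f (linCon A b) lam x = f x + ⟪lam, conVec A b x⟫ := by
  rw [inner_eq_sum]; rfl

theorem lagrangian_sub (lam mu : E m) (x : E n) :
    lagrangian f (linCon A b) mu x =
      lagrangian f (linCon A b) lam x + ⟪conVec A b x, mu - lam⟫ := by
  rw [lagrangian_eq, lagrangian_eq, inner_sub_right, real_inner_comm mu, real_inner_comm lam]; ring

theorem strongConvexOn_lagrangian {α : ℝ} (hc : StrongConvexOn univ α f) (lam : E m) :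
    StrongConvexOn univ α (lagrangian f (linCon A b) lam) := by
  have : lagrangian f (linCon A b) lam = fun x => f x + ⟪lam, conVec A b x⟫ :=
    funext fun x => lagrangian_eq lam x
  rw [this]
  refine hc.add_affine fun x y a c hac => ?_
  simp only [conVec_eq, map_add, map_smul, inner_sub_right, inner_add_right, inner_smul_right]
  linear_combination hac * ⟪lam, WithLp.toLp 2 b⟫

theorem hasFDerivAt_lagrangian (hf : Differentiable ℝ f) (lam : E m) (x : E n) :
    HasFDerivAt (lagrangian f (linCon A b) lam)
      (fderiv ℝ f x + (innerSL ℝ lam).comp (conMap A)) x := by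
  have : lagrangian f (linCon A b) lam =
      fun x => f x + (innerSL ℝ lam) (conMap A x - WithLp.toLp 2 b) :=
    funext fun x => lagrangian_eq lam x
  rw [this]
  exact (hf x).hasFDerivAt.add
    ((innerSL ℝ lam).hasFDerivAt.comp x ((conMap A).hasFDerivAt.sub_const _))

/-! ### Minimizers of the Lagrangian -/

/-- `x` minimizes the Lagrangian at `lam`. -/
def IsDualMin (f : E n → ℝ) (A : Matrix (Fin m) (Fin n) ℝ) (b : Fin m → ℝ) (lam : E m)
    (x : E n) : Prop :=
  IsMinOn (lagrangian f (linCon A b) lam) univ x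

theorem exists_isDualMin {α : ℝ} (hα : 0 < α) (hc : StrongConvexOn univ α f)
    (hf : Differentiable ℝ f) (lam : E m) : ∃ x, IsDualMin f A b lam x :=
  (strongConvexOn_lagrangian hc lam).exists_isMinOn hα
    fun x => (hasFDerivAt_lagrangian hf lam x).differentiableAt

namespace IsDualMin

variable {lam mu : E m} {x y : E n}

theorem isLeast (hx : IsDualMin f A b lam x) :
    IsLeast (lagrangian f (linCon A b) lam '' univ) (lagrangian f (linCon A b) lam x) :=
  ⟨mem_image_of_mem _ (mem_univ x), by rintro _ ⟨y, hy, rfl⟩; exact hx hy⟩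

theorem dual_eq (hx : IsDualMin f A b lam x) :
    dual univ f (linCon A b) lam = lagrangian f (linCon A b) lam x :=
  hx.isLeast.csInf_eq

/-- Stationarity of the Lagrangian. It makes the multiplier readable from the derivative of `f`,
which is the source of all curvature of the dual function. -/
theorem fderiv_apply (hx : IsDualMin f A b lam x) (hf : Differentiable ℝ f) (v : E n) :
    fderiv ℝ f x v = -⟪lam, conMap A v⟫ := by
  have h0 : fderiv ℝ (lagrangian f (linCon A b) lam) x = 0 :=
    IsLocalMin.fderiv_eq_zero (hx.isLocalMin univ_mem)
  rw [(hasFDerivAt_lagrangian hf lam x).fderiv] at h0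
  have := DFunLike.congr_fun h0 v
  simp only [add_apply, ContinuousLinearMap.comp_apply, innerSL_apply_apply,
    zero_apply] at this
  linarith

theorem of_fderiv {α : ℝ} (hα : 0 ≤ α) (hc : StrongConvexOn univ α f) (hf : Differentiable ℝ f)
    (h : ∀ v, fderiv ℝ f x v = -⟪lam, conMap A v⟫) : IsDualMin f A b lam x := fun y _ => by
  have h1 := (strongConvexOn_lagrangian (A := A) (b := b) hc lam).add_le_of_hasFDerivAt
    (hasFDerivAt_lagrangian hf lam x) y
  simp only [add_apply, ContinuousLinearMap.comp_apply, innerSL_apply_apply,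
    h] at h1
  have : 0 ≤ α / 2 * ‖y - x‖ ^ 2 := by positivity
  change lagrangian f (linCon A b) lam x ≤ lagrangian f (linCon A b) lam y
  linarith

variable {α : ℝ}

theorem add_sq_le (hx : IsDualMin f A b lam x) (hc : StrongConvexOn univ α f)
    (hf : Differentiable ℝ f) (y : E n) :
    dual univ f (linCon A b) lam + α / 2 * ‖y - x‖ ^ 2 ≤ lagrangian f (linCon A b) lam y := by
  have h1 := (strongConvexOn_lagrangian (A := A) (b := b) hc lam).add_le_of_hasFDerivAt
    (hasFDerivAt_lagrangian hf lam x) y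
  simp only [add_apply, ContinuousLinearMap.comp_apply, innerSL_apply_apply,
    hx.fderiv_apply hf] at h1
  rw [hx.dual_eq]
  linarith

/-- The values of the constraints at a minimizer form a supergradient of the dual function. -/
theorem dual_le (hx : IsDualMin f A b lam x) (hy : IsDualMin f A b mu y)
    (hc : StrongConvexOn univ α f) (hf : Differentiable ℝ f) :
    dual univ f (linCon A b) mu + α / 2 * ‖x - y‖ ^ 2 ≤
      dual univ f (linCon A b) lam + ⟪conVec A b x, mu - lam⟫ := by
  have h1 := hy.add_sq_le hc hf x
  rw [lagrangian_sub lam mu x, ← hx.dual_eq] at h1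
  exact h1

/-- The dual values cancel when `dual_le` is added to itself with the two points exchanged. -/
theorem sq_le_inner (hx : IsDualMin f A b lam x) (hy : IsDualMin f A b mu y)
    (hc : StrongConvexOn univ α f) (hf : Differentiable ℝ f) :
    α * ‖x - y‖ ^ 2 ≤ -⟪conVec A b x - conVec A b y, lam - mu⟫ := by
  have h1 := hx.dual_le hy hc hf
  have h2 := hy.dual_le hx hc hf
  rw [norm_sub_rev y x] at h2
  rw [← neg_sub lam mu, inner_neg_right] at h1
  rw [inner_sub_left]
  linarith

/-- Quadratic lower bound for the dual function. -/
theorem le_dual (hx : IsDualMin f A b lam x) (hy : IsDualMin f A b mu y) {B V : ℝ}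
    (hV0 : 0 < V) (hc : StrongConvexOn univ α f) (hf : Differentiable ℝ f)
    (hB : ∀ v, ‖conMap A v‖ ^ 2 ≤ B * ‖v‖ ^ 2) (hV : B ≤ V * α) :
    dual univ f (linCon A b) lam + ⟪conVec A b x, mu - lam⟫ ≤
      dual univ f (linCon A b) mu + V / 2 * ‖mu - lam‖ ^ 2 := by
  have h1 := hx.add_sq_le hc hf y
  have h2 := lagrangian_sub (f := f) (A := A) (b := b) lam mu y
  rw [← hy.dual_eq] at h2
  have h3 : ⟪conVec A b y, mu - lam⟫ =
      ⟪conVec A b x, mu - lam⟫ + ⟪conMap A (y - x), mu - lam⟫ := by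
    rw [← inner_add_left, ← conVec_sub (b := b), add_sub_cancel]
  have h4 := abs_real_inner_le_norm (conMap A (y - x)) (mu - lam)
  have h5 := neg_abs_le ⟪conMap A (y - x), mu - lam⟫
  have h6 := hB (y - x)
  set p := ‖conMap A (y - x)‖
  set r := ‖y - x‖
  set d := ‖mu - lam‖
  have hp : p ^ 2 ≤ V * α * r ^ 2 := h6.trans (by gcongr)
  -- Young's inequality `p d ≤ p²/(2V) + V d²/2`, with `p² ≤ V α r²`.
  suffices h : p * d ≤ α / 2 * r ^ 2 + V / 2 * d ^ 2 by linarith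
  have h7 : V * (p * d) ≤ V * (α / 2 * r ^ 2 + V / 2 * d ^ 2) := by
    nlinarith [sq_nonneg (p - V * d)]
  exact le_of_mul_le_mul_left h7 hV0

end IsDualMin

/-! ### Lipschitz constraints and smoothness of the dual function -/

theorem abs_apply_le_norm (v : E m) (k : Fin m) : |v k| ≤ ‖v‖ := by
  simpa using PiLp.norm_apply_le v k

theorem linCon_sub (x y : E n) (k : Fin m) :
    linCon A b k y - linCon A b k x = conMap A (y - x) k := by
  rw [← conVec_sub (b := b)]; rfl

theorem exists_stronglyConvexProblem (hfc : ∃ α : ℝ, 0 < α ∧ StrongConvexOn univ α f) :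
    ∃ α β, StronglyConvexProblem univ f (linCon A b) α β := by
  obtain ⟨α, hα, hc⟩ := hfc
  refine ⟨α, ‖conMap A‖ + 1, hα, hc, by positivity, fun k x _ y _ => ?_⟩
  rw [linCon_sub]
  calc |conMap A (y - x) k| ≤ ‖conMap A (y - x)‖ := abs_apply_le_norm _ k
    _ ≤ ‖conMap A‖ * ‖y - x‖ := (conMap A).le_opNorm _
    _ ≤ (‖conMap A‖ + 1) * ‖y - x‖ := by gcongr; linarith

/-- Each of the `m` coordinates contributes at most `β² ‖v‖²`; this is where the threshold `m β² /
α` for `V` originates. -/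
theorem StronglyConvexProblem.norm_sq_conMap_le {α β : ℝ}
    (h : StronglyConvexProblem univ f (linCon A b) α β) (v : E n) :
    ‖conMap A v‖ ^ 2 ≤ m * β ^ 2 * ‖v‖ ^ 2 := by
  have h1 : ∀ k, (conMap A v k) ^ 2 ≤ (β * ‖v‖) ^ 2 := fun k => by
    have := h.2.2.2 k 0 (mem_univ _) v (mem_univ _)
    rw [linCon_sub, sub_zero] at this
    exact sq_le_sq' (by linarith [neg_abs_le (conMap A v k)]) ((le_abs_self _).trans this)
  calc ‖conMap A v‖ ^ 2 = ∑ k, (conMap A v k) ^ 2 := EuclideanSpace.real_norm_sq_eq _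
    _ ≤ ∑ _k : Fin m, (β * ‖v‖) ^ 2 := Finset.sum_le_sum fun k _ => h1 k
    _ = m * β ^ 2 * ‖v‖ ^ 2 := by simp; ring

/-- Cauchy–Schwarz in `sq_le_inner`, divided by `‖x - y‖`. It transfers convergence of the queues to
the iterates. -/
theorem IsDualMin.norm_sub_le {lam mu : E m} {x y : E n} {α : ℝ} (hx : IsDualMin f A b lam x)
    (hy : IsDualMin f A b mu y) (hα : 0 < α) (hc : StrongConvexOn univ α f)
    (hf : Differentiable ℝ f) : ‖x - y‖ ≤ ‖conMap A‖ / α * ‖lam - mu‖ := by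
  have h1 := hx.sq_le_inner hy hc hf
  rw [conVec_sub] at h1
  have h2 := abs_real_inner_le_norm (conMap A (x - y)) (lam - mu)
  have h3 := neg_abs_le ⟪conMap A (x - y), lam - mu⟫
  have h4 := (conMap A).le_opNorm (x - y)
  have h5 : ‖conMap A (x - y)‖ * ‖lam - mu‖ ≤ ‖conMap A‖ * ‖x - y‖ * ‖lam - mu‖ := by gcongr
  rcases (norm_nonneg (x - y)).eq_or_lt with h0 | h0
  · rw [← h0]; positivity
  · rw [div_mul_eq_mul_div, le_div_iff₀ hα]
    have h6 : ‖x - y‖ * (‖x - y‖ * α) ≤ ‖x - y‖ * (‖conMap A‖ * ‖lam - mu‖) := by nlinarith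
    exact le_of_mul_le_mul_left h6 h0

theorem dualAttained {α : ℝ} (hα : 0 < α) (hc : StrongConvexOn univ α f)
    (hf : Differentiable ℝ f) : DualAttained univ f (linCon A b) := fun lam _ => by
  obtain ⟨x, hx⟩ := exists_isDualMin (A := A) (b := b) hα hc hf lam
  rw [hx.dual_eq]
  exact hx.isLeast

theorem exists_smoothDual {α : ℝ} (hα : 0 < α) (hc : StrongConvexOn univ α f)
    (hf : Differentiable ℝ f) : ∃ γ, SmoothDual univ f (linCon A b) γ := by
  choose X hX using exists_isDualMin (A := A) (b := b) hα hc hf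
  have hlip : ∀ lam mu, ‖conVec A b (X mu) - conVec A b (X lam)‖ ≤
      (‖conMap A‖ * (‖conMap A‖ / α) + 1) * ‖mu - lam‖ := fun lam mu => by
    rw [conVec_sub]
    calc ‖conMap A (X mu - X lam)‖ ≤ ‖conMap A‖ * ‖X mu - X lam‖ := (conMap A).le_opNorm _
      _ ≤ ‖conMap A‖ * (‖conMap A‖ / α * ‖mu - lam‖) := by
        gcongr; exact (hX mu).norm_sub_le (hX lam) hα hc hf
      _ ≤ _ := by nlinarith [norm_nonneg (mu - lam)]
  set γ := ‖conMap A‖ * (‖conMap A‖ / α) + 1 with hγ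
  refine ⟨γ, by positivity, fun lam => conVec A b (X lam), fun lam _ => ?_,
    fun lam _ mu _ => hlip lam mu⟩
  rw [hasGradientWithinAt_iff_isLittleO]
  -- The supergradient inequalities at `lam` and at `mu` enclose the remainder between `⟪g(X mu) -
  -- g(X lam), mu - lam⟫` and `0`, and `hlip` bounds the former quadratically.
  have hO : (fun mu => dual univ f (linCon A b) mu - dual univ f (linCon A b) lam -
      ⟪conVec A b (X lam), mu - lam⟫) =O[𝓝[orthant m] lam] fun mu => ‖mu - lam‖ ^ 2 := by
    refine Asymptotics.IsBigO.of_bound γ (Eventually.of_forall fun mu => ?_)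
    have h1 := (hX lam).dual_le (hX mu) hc hf
    have h2 := (hX mu).dual_le (hX lam) hc hf
    have h3 := abs_real_inner_le_norm (conVec A b (X mu) - conVec A b (X lam)) (mu - lam)
    rw [← neg_sub mu lam, inner_neg_right] at h2
    rw [inner_sub_left] at h3
    have h4 := mul_le_mul_of_nonneg_right (hlip lam mu) (norm_nonneg (mu - lam))
    have h5 : 0 ≤ α / 2 * ‖X lam - X mu‖ ^ 2 := by positivity
    have h6 : 0 ≤ α / 2 * ‖X mu - X lam‖ ^ 2 := by positivity
    have h7 := neg_abs_le (⟪conVec A b (X mu), mu - lam⟫ - ⟪conVec A b (X lam), mu - lam⟫)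
    rw [Real.norm_eq_abs, Real.norm_eq_abs, abs_of_nonneg (sq_nonneg ‖mu - lam‖), abs_le]
    constructor <;> nlinarith [norm_nonneg (mu - lam)]
  refine hO.trans_isLittleO ?_
  have ho : (fun v : E m => ‖v‖ ^ 2) =o[𝓝 0] fun v => v := by
    simpa using Asymptotics.isLittleO_norm_pow_id (E' := E m) one_lt_two
  have ht : Tendsto (fun mu : E m => mu - lam) (𝓝[orthant m] lam) (𝓝 0) := by
    have : Tendsto (fun mu : E m => mu - lam) (𝓝 lam) (𝓝 (lam - lam)) :=
      Continuous.tendsto (by fun_prop) lam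
    rw [sub_self] at this
    exact this.mono_left nhdsWithin_le_nhds
  exact ho.comp_tendsto ht

/-! ### Lagrange multipliers -/

theorem IsLagrangeMultiplier.dual_eq {lams : E m}
    (h : IsLagrangeMultiplier univ f (linCon A b) lams)
    (hxs : IsOptimal univ f (linCon A b) xs) : dual univ f (linCon A b) lams = f xs := by
  have : IsLeast (f '' feasible univ (linCon A b)) (f xs) :=
    ⟨mem_image_of_mem _ hxs.1, by rintro _ ⟨y, hy, rfl⟩; exact hxs.2 hy⟩
  exact h.2.unique this

theorem IsLagrangeMultiplier.mul_nonpos {lams : E m}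
    (h : IsLagrangeMultiplier univ f (linCon A b) lams)
    (hxs : IsOptimal univ f (linCon A b) xs) (k : Fin m) : lams k * linCon A b k xs ≤ 0 :=
  mul_nonpos_of_nonneg_of_nonpos (h.1 k) (hxs.1.2 k)

/-- Complementary slackness. -/
theorem IsLagrangeMultiplier.mul_eq_zero {lams : E m}
    (h : IsLagrangeMultiplier univ f (linCon A b) lams)
    (hxs : IsOptimal univ f (linCon A b) xs)
    (hatt : DualAttained univ f (linCon A b)) (k : Fin m) : lams k * linCon A b k xs = 0 := by
  -- Evaluating the Lagrangian at `xs` shows that a sum of nonpositive terms is nonnegative.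
  have h1 := (hatt lams h.1).2 (mem_image_of_mem _ (mem_univ xs))
  rw [h.dual_eq hxs, lagrangian, le_add_iff_nonneg_right] at h1
  have h2 := (Finset.sum_eq_zero_iff_of_nonpos fun k _ => h.mul_nonpos hxs k).1
    (le_antisymm (Finset.sum_nonpos fun k _ => h.mul_nonpos hxs k) h1)
  exact h2 k (Finset.mem_univ k)

theorem IsLagrangeMultiplier.isDualMin {lams : E m}
    (h : IsLagrangeMultiplier univ f (linCon A b) lams)
    (hxs : IsOptimal univ f (linCon A b) xs)
    (hatt : DualAttained univ f (linCon A b)) : IsDualMin f A b lams xs := fun y _ => by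
  have h1 := (hatt lams h.1).2 (mem_image_of_mem _ (mem_univ y))
  rw [h.dual_eq hxs] at h1
  change lagrangian f (linCon A b) lams xs ≤ lagrangian f (linCon A b) lams y
  rw [lagrangian, Finset.sum_eq_zero fun k _ => h.mul_eq_zero hxs hatt k, add_zero]
  exact h1

/-! ### Right inverses of the constraint rows and existence of a multiplier -/

/-- The linear map `R` is a right inverse of the rows of `A` with index in `S`. -/
def IsRowInverse (A : Matrix (Fin m) (Fin n) ℝ) (S : Set (Fin m)) (R : E m →L[ℝ] E n) : Prop :=
  ∀ w, ∀ k ∈ S, conMap A (R w) k = w k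

theorem exists_isRowInverse_univ (hA : A.rank = m) : ∃ R, IsRowInverse A univ R := by
  have hr : A.mulVecLin.range = ⊤ := by
    apply Submodule.eq_top_of_finrank_eq
    rw [Module.finrank_fin_fun]
    exact hA
  obtain ⟨g, hg⟩ := LinearMap.exists_rightInverse_of_surjective _ hr
  refine ⟨(((WithLp.linearEquiv 2 ℝ (Fin n → ℝ)).symm.toLinearMap ∘ₗ g) ∘ₗ
    (WithLp.linearEquiv 2 ℝ (Fin m → ℝ)).toLinearMap).toContinuousLinearMap, fun w k _ => ?_⟩
  exact congrFun (DFunLike.congr_fun hg w.ofLp) k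

theorem exists_isRowInverse_active
    (hA : (activeSubmatrix A b xs).rank = Nat.card (activeSet A b xs)) :
    ∃ R, IsRowInverse A (activeSet A b xs) R := by
  classical
  have hr : (activeSubmatrix A b xs).mulVecLin.range = ⊤ := by
    apply Submodule.eq_top_of_finrank_eq
    rw [Module.finrank_fintype_fun_eq_card, ← Nat.card_eq_fintype_card]
    exact hA
  obtain ⟨g, hg⟩ := LinearMap.exists_rightInverse_of_surjective _ hr
  refine ⟨(((WithLp.linearEquiv 2 ℝ (Fin n → ℝ)).symm.toLinearMap ∘ₗ g) ∘ₗ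
    (LinearMap.funLeft ℝ ℝ (fun k : activeSet A b xs => (k : Fin m))) ∘ₗ
    (WithLp.linearEquiv 2 ℝ (Fin m → ℝ)).toLinearMap).toContinuousLinearMap, fun w k hk => ?_⟩
  exact congrFun (DFunLike.congr_fun hg (fun j : activeSet A b xs => w.ofLp j)) ⟨k, hk⟩

theorem IsRowInverse.mono {S S' : Set (Fin m)} {R : E m →L[ℝ] E n} (h : IsRowInverse A S R)
    (hS : S' ⊆ S) : IsRowInverse A S' R := fun w k hk => h w k (hS hk)

theorem linCon_neg_of_notMem (hxs : IsOptimal univ f (linCon A b) xs) {k : Fin m}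
    (hk : k ∉ activeSet A b xs) : linCon A b k xs < 0 :=
  lt_of_le_of_ne (hxs.1.2 k) fun h => hk (sub_eq_zero.1 h)

theorem linCon_eq_zero_of_mem {k : Fin m} (hk : k ∈ activeSet A b xs) : linCon A b k xs = 0 :=
  sub_eq_zero.2 hk

/-- Inactive constraints hold strictly, so short steps along `v` remain feasible and the difference
quotients of `f` are nonnegative. -/
theorem fderiv_nonneg_of_feasible_direction (hxs : IsOptimal univ f (linCon A b) xs)
    (hf : Differentiable ℝ f) {v : E n} (hv : ∀ k ∈ activeSet A b xs, conMap A v k ≤ 0) :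
    0 ≤ fderiv ℝ f xs v := by
  have hline : HasDerivAt (fun s : ℝ => f (xs + s • v)) (fderiv ℝ f xs v) 0 := by
    have h1 : HasDerivAt (fun s : ℝ => xs + s • v) v 0 := by
      simpa using ((hasDerivAt_id (0 : ℝ)).smul_const v).const_add xs
    have h2 : HasFDerivAt f (fderiv ℝ f xs) (xs + (0 : ℝ) • v) := by
      simpa using (hf xs).hasFDerivAt
    exact h2.comp_hasDerivAt 0 h1
  refine ge_of_tendsto hline.tendsto_slope_zero_right ?_
  have hlin : ∀ (s : ℝ) k, linCon A b k (xs + s • v) = linCon A b k xs + s * conMap A v k :=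
    fun s k => by
      have := linCon_sub (A := A) (b := b) xs (xs + s • v) k
      rw [add_sub_cancel_left, map_smul] at this
      simp only [PiLp.smul_apply, smul_eq_mul] at this
      linarith
  have hfeas : ∀ᶠ s : ℝ in 𝓝[>] 0, ∀ k, linCon A b k (xs + s • v) ≤ 0 := by
    rw [eventually_all]
    intro k
    by_cases hk : k ∈ activeSet A b xs
    · filter_upwards [self_mem_nhdsWithin] with s hs
      rw [hlin, linCon_eq_zero_of_mem hk, zero_add]
      exact mul_nonpos_of_nonneg_of_nonpos (le_of_lt hs) (hv k hk)
    · have hneg := linCon_neg_of_notMem hxs hk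
      have ht : Tendsto (fun s : ℝ => linCon A b k (xs + s • v)) (𝓝[>] 0)
          (𝓝 (linCon A b k xs + 0 * conMap A v k)) := by
        simp only [hlin]
        exact (Continuous.tendsto (by fun_prop) 0).mono_left nhdsWithin_le_nhds
      rw [zero_mul, add_zero] at ht
      exact (ht.eventually_lt_const hneg).mono fun s hs => hs.le
  filter_upwards [hfeas, self_mem_nhdsWithin] with s hs hs0
  have h1 : f xs ≤ f (xs + s • v) := hxs.2 ⟨mem_univ _, hs⟩
  simp only [zero_add, zero_smul, add_zero, smul_eq_mul]
  exact mul_nonneg (inv_nonneg.2 (le_of_lt hs0)) (sub_nonneg.2 h1)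

open Classical in
/-- The projection to the coordinates in `S`. -/
noncomputable def restr (S : Set (Fin m)) (v : E m) : E m :=
  WithLp.toLp 2 fun k => if k ∈ S then v k else 0

theorem restr_of_mem {S : Set (Fin m)} {k : Fin m} (hk : k ∈ S) (v : E m) : restr S v k = v k :=
  if_pos hk

theorem restr_of_notMem {S : Set (Fin m)} {k : Fin m} (hk : k ∉ S) (v : E m) : restr S v k = 0 :=
  if_neg hk

theorem strongDuality_of_isRowInverse (hxs : IsOptimal univ f (linCon A b) xs) {α : ℝ}
    (hα : 0 < α) (hc : StrongConvexOn univ α f) (hf : Differentiable ℝ f) {R : E m →L[ℝ] E n}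
    (hR : IsRowInverse A (activeSet A b xs) R) : StrongDuality univ f (linCon A b) := by
  set S := activeSet A b xs
  -- Moving along `-R e_k` relaxes the active constraint `k` at unit rate and leaves the other
  -- active ones fixed; the multiplier is the resulting rate of increase of `f`.
  set lams : E m := restr S (WithLp.toLp 2 fun k => -fderiv ℝ f xs (R (EuclideanSpace.single k 1)))
    with hlams
  have hmem : lams ∈ orthant m := fun k => by
    by_cases hk : k ∈ S
    · rw [hlams, restr_of_mem hk]
      have := fderiv_nonneg_of_feasible_direction hxs hf
        (v := -R (EuclideanSpace.single k 1)) fun j hj => by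
          rw [map_neg, PiLp.neg_apply, hR _ j hj, PiLp.single_apply]
          split_ifs <;> norm_num
      rwa [map_neg] at this
    · rw [hlams, restr_of_notMem hk]
  have hslack : ∀ k, lams k * linCon A b k xs = 0 := fun k => by
    by_cases hk : k ∈ S
    · rw [linCon_eq_zero_of_mem hk, mul_zero]
    · rw [hlams, restr_of_notMem hk, zero_mul]
  have hgrad : ∀ v, fderiv ℝ f xs v = -⟪lams, conMap A v⟫ := fun v => by
    -- Both `u` and `-u` are feasible directions, so the derivative of `f` factors through the
    -- active rows.
    have hker : ∀ u : E n, (∀ k ∈ S, conMap A u k = 0) → fderiv ℝ f xs u = 0 := fun u hu => by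
      have h1 := fderiv_nonneg_of_feasible_direction hxs hf fun k hk => (hu k hk).le
      have h2 := fderiv_nonneg_of_feasible_direction hxs hf (v := -u) fun k hk => by
        rw [map_neg, PiLp.neg_apply, hu k hk, neg_zero]
      rw [map_neg] at h2
      linarith
    have h0 := hker (v - R (restr S (conMap A v))) fun k hk => by
      rw [map_sub, PiLp.sub_apply, hR _ k hk, restr_of_mem hk, sub_self]
    rw [map_sub, sub_eq_zero] at h0
    have hsum : restr S (conMap A v) =
        ∑ k, restr S (conMap A v) k • EuclideanSpace.single k (1 : ℝ) := by
      ext j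
      simp [Finset.sum_apply, Pi.single_apply]
    rw [h0, hsum, map_sum, map_sum, inner_eq_sum, ← Finset.sum_neg_distrib]
    refine Finset.sum_congr rfl fun k _ => ?_
    rw [map_smul, map_smul, smul_eq_mul]
    by_cases hk : k ∈ S
    · rw [restr_of_mem hk, hlams, restr_of_mem hk]; ring
    · rw [restr_of_notMem hk, hlams, restr_of_notMem hk]; ring
  have hmin : IsDualMin f A b lams xs := IsDualMin.of_fderiv hα.le hc hf hgrad
  refine ⟨lams, hmem, ?_⟩
  rw [hmin.dual_eq, lagrangian, Finset.sum_eq_zero fun k _ => hslack k, add_zero]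
  exact ⟨mem_image_of_mem _ hxs.1, by rintro _ ⟨y, hy, rfl⟩; exact hxs.2 hy⟩

/-! ### Curvature of the dual function -/

theorem restr_add_restr_compl (S : Set (Fin m)) (v : E m) : restr S v + restr Sᶜ v = v := by
  ext k
  rw [PiLp.add_apply]
  by_cases hk : k ∈ S
  · rw [restr_of_mem hk, restr_of_notMem (notMem_compl_iff.2 hk), add_zero]
  · rw [restr_of_notMem hk, restr_of_mem (show k ∈ Sᶜ from hk), zero_add]

theorem norm_sq_restr_add (S : Set (Fin m)) (v : E m) :
    ‖restr S v‖ ^ 2 + ‖restr Sᶜ v‖ ^ 2 = ‖v‖ ^ 2 := by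
  simp only [EuclideanSpace.real_norm_sq_eq, ← Finset.sum_add_distrib]
  refine Finset.sum_congr rfl fun k _ => ?_
  by_cases hk : k ∈ S
  · rw [restr_of_mem hk, restr_of_notMem (notMem_compl_iff.2 hk)]; ring
  · rw [restr_of_notMem hk, restr_of_mem (show k ∈ Sᶜ from hk)]; ring

/-- Test the difference of the two stationarity equations against `R w`. Since `A R w` agrees with
`w` on `S`, where `w` is supported, this produces `‖w‖²` and a coupling with the complementary part.
-/
theorem IsDualMin.norm_restr_le {lam mu : E m} {x y : E n} (hx : IsDualMin f A b lam x)
    (hy : IsDualMin f A b mu y) (hf : Differentiable ℝ f) {S : Set (Fin m)} {R : E m →L[ℝ] E n}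
    (hR : IsRowInverse A S R) :
    ‖restr S (lam - mu)‖ ≤ ‖R‖ * ‖fderiv ℝ f x - fderiv ℝ f y‖ +
      ‖conMap A‖ * ‖R‖ * ‖restr Sᶜ (lam - mu)‖ := by
  set w := restr S (lam - mu) with hw
  set u := restr Sᶜ (lam - mu) with hu
  have hwu : w + u = lam - mu := restr_add_restr_compl S _
  have h1 : (fderiv ℝ f x - fderiv ℝ f y) (R w) = -‖w‖ ^ 2 - ⟪u, conMap A (R w)⟫ := by
    have h2 : ⟪w, conMap A (R w)⟫ = ‖w‖ ^ 2 := by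
      rw [inner_eq_sum, EuclideanSpace.real_norm_sq_eq]
      refine Finset.sum_congr rfl fun k _ => ?_
      by_cases hk : k ∈ S
      · rw [hR w k hk]; ring
      · rw [hw, restr_of_notMem hk]; ring
    rw [sub_apply, hx.fderiv_apply hf, hy.fderiv_apply hf]
    have h3 : ⟪lam, conMap A (R w)⟫ - ⟪mu, conMap A (R w)⟫ =
        ⟪w, conMap A (R w)⟫ + ⟪u, conMap A (R w)⟫ := by
      rw [← inner_sub_left, ← inner_add_left, hwu]
    linarith
  have h2 := (fderiv ℝ f x - fderiv ℝ f y).le_opNorm (R w)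
  rw [Real.norm_eq_abs] at h2
  have h3 := neg_abs_le ((fderiv ℝ f x - fderiv ℝ f y) (R w))
  have h4 := abs_real_inner_le_norm u (conMap A (R w))
  have h5 := neg_abs_le ⟪u, conMap A (R w)⟫
  have h6 : ‖R w‖ ≤ ‖R‖ * ‖w‖ := R.le_opNorm w
  have h7 : ‖conMap A (R w)‖ ≤ ‖conMap A‖ * (‖R‖ * ‖w‖) :=
    ((conMap A).le_opNorm _).trans (by gcongr)
  have h8 : ‖fderiv ℝ f x - fderiv ℝ f y‖ * ‖R w‖ ≤
      ‖fderiv ℝ f x - fderiv ℝ f y‖ * (‖R‖ * ‖w‖) := by gcongr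
  have h9 : ‖u‖ * ‖conMap A (R w)‖ ≤ ‖u‖ * (‖conMap A‖ * (‖R‖ * ‖w‖)) := by gcongr
  rcases (norm_nonneg w).eq_or_lt with h0 | h0
  · rw [← h0]; positivity
  · have : ‖w‖ * ‖w‖ ≤ ‖w‖ * (‖R‖ * ‖fderiv ℝ f x - fderiv ℝ f y‖ +
        ‖conMap A‖ * ‖R‖ * ‖u‖) := by nlinarith
    exact le_of_mul_le_mul_left this h0

theorem exists_lipschitz_ball {F G : Type*} [NormedAddCommGroup F] [NormedSpace ℝ F]
    [NormedAddCommGroup G] [NormedSpace ℝ G] {h : F → G} {a : F} (hh : ContDiffAt ℝ 1 h a) :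
    ∃ K : ℝ, 0 ≤ K ∧ ∃ δ > 0, ∀ x y, ‖x - a‖ < δ → ‖y - a‖ < δ → ‖h x - h y‖ ≤ K * ‖x - y‖ := by
  obtain ⟨K, t, ht, hK⟩ := hh.exists_lipschitzOnWith
  obtain ⟨δ, hδ, hb⟩ := Metric.mem_nhds_iff.1 ht
  refine ⟨K, K.2, δ, hδ, fun x y hx hy => hK.norm_sub_le (hb ?_) (hb ?_)⟩
  · rwa [mem_ball_iff_norm]
  · rwa [mem_ball_iff_norm]

/-- Multipliers near `lams` have minimizers of the Lagrangian near `xs`, where the derivative of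
`f` is Lipschitz continuous. -/
theorem exists_fderiv_lipschitz_near {α : ℝ} (hα : 0 < α) (hc : StrongConvexOn univ α f)
    (hf : ContDiff ℝ 2 f) {lams : E m} (hs : IsDualMin f A b lams xs) :
    ∃ K : ℝ, 0 ≤ K ∧ ∃ D > 0, ∀ lam mu x y, IsDualMin f A b lam x → IsDualMin f A b mu y →
      ‖lam - lams‖ ≤ D → ‖mu - lams‖ ≤ D → ‖fderiv ℝ f x - fderiv ℝ f y‖ ≤ K * ‖x - y‖ := by
  have hd : Differentiable ℝ f := hf.differentiable two_ne_zero
  obtain ⟨K, hK, δ, hδ, h⟩ := exists_lipschitz_ball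
    ((hf.fderiv_right (m := 1) (by norm_num)).contDiffAt (x := xs))
  have hC : 0 < ‖conMap A‖ / α + 1 := by positivity
  have hnear : ∀ lam x, IsDualMin f A b lam x → ‖lam - lams‖ ≤ δ / 2 / (‖conMap A‖ / α + 1) →
      ‖x - xs‖ < δ := fun lam x hx hl => by
    rw [le_div_iff₀ hC] at hl
    have h1 := hx.norm_sub_le hs hα hc hd
    nlinarith [norm_nonneg (lam - lams)]
  exact ⟨K, hK, δ / 2 / (‖conMap A‖ / α + 1), by positivity, fun lam mu x y hx hy hl hm =>
    h x y (hnear lam x hx hl) (hnear mu y hy hm)⟩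

theorem convex_orthant_inter_ball (lams : E m) (D : ℝ) :
    Convex ℝ {lam | lam ∈ orthant m ∧ ‖lam - lams‖ ≤ D} := by
  have h1 : Convex ℝ (orthant m) := fun u hu v hv a c ha hc _ k => by
    rw [PiLp.add_apply, PiLp.smul_apply, PiLp.smul_apply, smul_eq_mul, smul_eq_mul]
    exact add_nonneg (mul_nonneg ha (hu k)) (mul_nonneg hc (hv k))
  have h2 := h1.inter (convex_closedBall lams D)
  convert h2 using 1
  ext v
  exact and_congr_right fun _ => mem_closedBall_iff_norm.symm

/-- If all rows are independent, then the dual function is locally strongly concave. -/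
theorem exists_locallyStronglyConcaveDualAt {α : ℝ} (hα : 0 < α) (hc : StrongConvexOn univ α f)
    (hf : ContDiff ℝ 2 f) {lams : E m} (hs : IsDualMin f A b lams xs) {R : E m →L[ℝ] E n}
    (hR : IsRowInverse A univ R) :
    ∃ D L, LocallyStronglyConcaveDualAt univ f (linCon A b) lams D L := by
  have hd : Differentiable ℝ f := hf.differentiable two_ne_zero
  obtain ⟨K, hK, D, hD, h⟩ := exists_fderiv_lipschitz_near hα hc hf hs
  choose X hX using exists_isDualMin (A := A) (b := b) hα hc hd
  set P := ‖R‖ * K + 1 with hP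
  have hP0 : 0 < P := by positivity
  -- With all rows invertible, `‖lam - mu‖ ≤ P ‖X lam - X mu‖`, so the quadratic gain in `dual_le`
  -- becomes one in the multipliers, of modulus `α / P²`.
  have hXdist : ∀ lam mu, ‖lam - lams‖ ≤ D → ‖mu - lams‖ ≤ D →
      α / P ^ 2 / 2 * ‖lam - mu‖ ^ 2 ≤ α / 2 * ‖X lam - X mu‖ ^ 2 := fun lam mu hl hm => by
    have h1 := (hX lam).norm_restr_le (hX mu) hd hR
    have h2 : restr univᶜ (lam - mu) = 0 := by
      ext k; exact restr_of_notMem (notMem_compl_iff.2 (mem_univ k)) _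
    have h3 := restr_add_restr_compl univ (lam - mu)
    rw [h2, add_zero] at h3
    rw [h2, h3, norm_zero, mul_zero, add_zero] at h1
    have h4 : ‖lam - mu‖ ≤ P * ‖X lam - X mu‖ := by
      have := mul_le_mul_of_nonneg_left (h _ _ _ _ (hX lam) (hX mu) hl hm) (norm_nonneg R)
      nlinarith [norm_nonneg (X lam - X mu)]
    have h5 := pow_le_pow_left₀ (norm_nonneg _) h4 2
    calc α / P ^ 2 / 2 * ‖lam - mu‖ ^ 2 ≤ α / P ^ 2 / 2 * (P * ‖X lam - X mu‖) ^ 2 := by gcongr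
      _ = α / 2 * ‖X lam - X mu‖ ^ 2 := by field_simp
  refine ⟨D, α / P ^ 2, hD, by positivity, convex_orthant_inter_ball lams D, ?_⟩
  intro lam hlam mu hmu a c ha hc' hac
  have hnu := convex_orthant_inter_ball lams D hlam hmu ha hc' hac
  set nu := a • lam + c • mu with hnudef
  have e1 : lam - nu = c • (lam - mu) := by
    rw [hnudef, ← sub_eq_iff_eq_add.2 hac.symm]; module
  have e2 : mu - nu = (-a) • (lam - mu) := by
    rw [hnudef, ← sub_eq_iff_eq_add'.2 hac.symm]; module
  -- Combine the supergradient inequalities at `nu` with weights `a` and `c`: the linear terms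
  -- cancel, and the quadratic ones add up to `a c² + c a² = a c`.
  have h1 := (hX nu).dual_le (hX lam) hc hd
  have h2 := (hX nu).dual_le (hX mu) hc hd
  have h3 := hXdist nu lam hnu.2 hlam.2
  have h4 := hXdist nu mu hnu.2 hmu.2
  rw [norm_sub_rev, e1, norm_smul, Real.norm_eq_abs, mul_pow, sq_abs] at h3
  rw [norm_sub_rev, e2, norm_smul, Real.norm_eq_abs, mul_pow, sq_abs] at h4
  rw [e1, inner_smul_right] at h1
  rw [e2, inner_smul_right] at h2
  simp only [smul_eq_mul]
  set r := ‖lam - mu‖ ^ 2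
  set L := α / P ^ 2
  have h5 := mul_le_mul_of_nonneg_left (h1.trans' (add_le_add_right h3 _)) ha
  have h6 := mul_le_mul_of_nonneg_left (h2.trans' (add_le_add_right h4 _)) hc'
  obtain rfl : c = 1 - a := by linarith
  nlinarith

/-- If the active rows are independent, then the dual function is locally quadratic. -/
theorem exists_locallyQuadraticDualAt (hxs : IsOptimal univ f (linCon A b) xs) {α : ℝ}
    (hα : 0 < α) (hc : StrongConvexOn univ α f) (hf : ContDiff ℝ 2 f) {lams : E m}
    (hl : IsLagrangeMultiplier univ f (linCon A b) lams) {R : E m →L[ℝ] E n}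
    (hR : IsRowInverse A (activeSet A b xs) R) :
    ∃ D L, LocallyQuadraticDualAt univ f (linCon A b) lams D L := by
  have hd : Differentiable ℝ f := hf.differentiable two_ne_zero
  have hatt := dualAttained (A := A) (b := b) hα hc hd
  have hs := hl.isDualMin hxs hatt
  obtain ⟨K, hK, D, hD, h⟩ := exists_fderiv_lipschitz_near hα hc hf hs
  set S := activeSet A b xs with hS
  -- A common slack for the inactive constraints.
  obtain ⟨δ, hδall, hδ⟩ : ∃ δ : ℝ, (∀ k, k ∉ S → linCon A b k xs ≤ -δ) ∧ 0 < δ := by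
    have h1 : ∀ᶠ δ : ℝ in 𝓝[>] 0, ∀ k, k ∉ S → linCon A b k xs ≤ -δ := by
      rw [eventually_all]
      intro k
      by_cases hk : k ∈ S
      · exact Eventually.of_forall fun _ h => absurd hk h
      · filter_upwards [Ioo_mem_nhdsGT (neg_pos.2 (linCon_neg_of_notMem hxs hk))] with δ hδ _
        linarith [hδ.2]
    exact (h1.and self_mem_nhdsWithin).exists
  set P := ‖R‖ * K
  set M := ‖conMap A‖ * ‖R‖
  have hP0 : 0 ≤ P := by positivity
  have hM0 : 0 ≤ M := by positivity
  have hN : 0 < 2 * P ^ 2 + 2 * M ^ 2 + 1 := by positivity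
  -- Radius at most `1` gives `λ_k² ≤ λ_k` for inactive `k`, so the linear loss `δ λ_k` dominates a
  -- quadratic one. The denominator comes from `w² + u² ≤ 2 P² r² + (2 M² + 1) u²`.
  refine ⟨min D 1, min (α / 2) δ / (2 * P ^ 2 + 2 * M ^ 2 + 1), lt_min hD one_pos,
    by positivity, fun lam hlam hdist => ?_⟩
  obtain ⟨x, hx⟩ := exists_isDualMin (A := A) (b := b) hα hc hd lam
  have h1 := hs.dual_le hx hc hd
  have h2 := hx.norm_restr_le hs hd hR
  have h3 := h _ _ _ _ hx hs (hdist.trans (min_le_left _ _)) (by simpa using hD.le)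
  have h4 := norm_sq_restr_add S (lam - lams)
  have h5 : ⟪conVec A b xs, lam - lams⟫ ≤ -δ * ‖restr Sᶜ (lam - lams)‖ ^ 2 := by
    rw [inner_eq_sum, EuclideanSpace.real_norm_sq_eq, Finset.mul_sum]
    refine Finset.sum_le_sum fun k _ => ?_
    rw [conVec_apply]
    by_cases hk : k ∈ S
    · rw [linCon_eq_zero_of_mem hk, restr_of_notMem (notMem_compl_iff.2 hk)]; simp
    · rw [restr_of_mem (show k ∈ Sᶜ from hk)]
      have hz : lams k = 0 := (mul_eq_zero.1 (hl.mul_eq_zero hxs hatt k)).resolve_right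
        (linCon_neg_of_notMem hxs hk).ne
      have hb := (abs_apply_le_norm (lam - lams) k).trans (hdist.trans (min_le_right _ _))
      rw [PiLp.sub_apply, hz, sub_zero] at hb ⊢
      have hb2 := (le_abs_self _).trans hb
      have hb3 := hlam k
      have hb4 := hδall k hk
      have hb5 : lam k ^ 2 ≤ lam k := by nlinarith
      nlinarith
  rw [norm_sub_rev xs x] at h1
  set w := ‖restr S (lam - lams)‖
  set u := ‖restr Sᶜ (lam - lams)‖
  set r := ‖x - xs‖
  have h6 : w ≤ P * r + M * u := h2.trans (by
    have := mul_le_mul_of_nonneg_left h3 (norm_nonneg R)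
    linarith)
  have h7 : w ^ 2 ≤ 2 * P ^ 2 * r ^ 2 + 2 * M ^ 2 * u ^ 2 := by
    have := pow_le_pow_left₀ (norm_nonneg _) h6 2
    nlinarith [sq_nonneg (P * r - M * u)]
  have hmin1 : min (α / 2) δ ≤ α / 2 := min_le_left _ _
  have hmin2 : min (α / 2) δ ≤ δ := min_le_right _ _
  have hmin0 : 0 ≤ min (α / 2) δ := by positivity
  have h8 : min (α / 2) δ / (2 * P ^ 2 + 2 * M ^ 2 + 1) * ‖lam - lams‖ ^ 2 ≤
      min (α / 2) δ * (r ^ 2 + u ^ 2) := by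
    rw [div_mul_eq_mul_div, div_le_iff₀ hN, mul_assoc]
    gcongr
    nlinarith [mul_nonneg (sq_nonneg M) (sq_nonneg r), mul_nonneg (sq_nonneg P) (sq_nonneg u),
      sq_nonneg r, sq_nonneg u]
  have h9 := mul_le_mul_of_nonneg_right hmin1 (sq_nonneg r)
  have h10 := mul_le_mul_of_nonneg_right hmin2 (sq_nonneg u)
  linarith

/-! ### The scaled queues -/

theorem lagrangian_inv_smul {V : ℝ} (hV : 0 < V) (Q : E m) (y : E n) :
    V * lagrangian f (linCon A b) (V⁻¹ • Q) y = V * f y + ∑ k, Q k * linCon A b k y := by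
  rw [lagrangian, mul_add, Finset.mul_sum]
  congr 1
  refine Finset.sum_congr rfl fun k _ => ?_
  rw [PiLp.smul_apply, smul_eq_mul]
  field_simp

theorem isDualMin_inv_smul_iff {V : ℝ} (hV : 0 < V) (Q : E m) (x : E n) :
    IsDualMin f A b (V⁻¹ • Q) x ↔
      IsMinOn (fun y => V * f y + ∑ k, Q k * linCon A b k y) univ x := by
  simp only [IsDualMin, isMinOn_univ_iff, ← lagrangian_inv_smul hV Q, mul_le_mul_iff_right₀ hV]

theorem runsExist {α : ℝ} (hα : 0 < α) (hc : StrongConvexOn univ α f)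
    (hf : Differentiable ℝ f) : RunsExist univ f (linCon A b) := by
  intro V hV Q₀ hQ₀
  choose X hX using exists_isDualMin (A := A) (b := b) hα hc hf
  let Q : ℕ → E m := fun t => Nat.rec Q₀
    (fun _ q => WithLp.toLp 2 fun k => max (q k + linCon A b k (X (V⁻¹ • q))) 0) t
  let x : ℕ → E n := fun t => X (V⁻¹ • Q t)
  -- Indexing by `2 * (t / 2)` repeats the preceding even value at odd `t`. At `t = 0` and `t = 1`
  -- the factor is `0⁻¹ = 0`, a harmless choice of the arbitrary start.
  let xbar : ℕ → E n := fun t =>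
    (((2 * (t / 2) : ℕ) : ℝ) / 2)⁻¹ • ∑ τ ∈ Finset.Icc (t / 2) (2 * (t / 2) - 1), x τ
  refine ⟨x, Q, xbar, ⟨hV, hQ₀, fun _ => mem_univ _,
    fun t => (isDualMin_inv_smul_iff hV (Q t) _).1 (hX _), fun _ _ => rfl, fun t ht => ?_,
    fun t ht => ?_⟩, rfl⟩
  · have h2 : 2 * ((t + 1) / 2) = t + 1 := Nat.two_mul_div_two_of_even ht
    simp only [xbar, h2, Nat.add_sub_cancel]
  · have h2 : (t + 1) / 2 = t / 2 := by
      obtain ⟨j, hj⟩ := ht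
      omega
    simp only [xbar, h2]

namespace IsRun

variable {V : ℝ} {x : ℕ → E n} {Q : ℕ → E m} {xbar : ℕ → E n}

theorem isDualMin (h : IsRun univ f (linCon A b) V x Q xbar) (t : ℕ) :
    IsDualMin f A b (V⁻¹ • Q t) (x t) :=
  (isDualMin_inv_smul_iff h.V_pos (Q t) (x t)).2 (h.argmin t)

theorem smul_mem_orthant (h : IsRun univ f (linCon A b) V x Q xbar) (t : ℕ) :
    V⁻¹ • Q t ∈ orthant m := fun k => by
  have hQ : 0 ≤ Q t k := by
    cases t with
    | zero => exact h.init k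
    | succ t => rw [h.queue]; exact le_max_right _ _
  rw [PiLp.smul_apply, smul_eq_mul]
  exact mul_nonneg (inv_nonneg.2 h.V_pos.le) hQ

theorem smul_queue (h : IsRun univ f (linCon A b) V x Q xbar) (t : ℕ) (k : Fin m) :
    (V⁻¹ • Q (t + 1)) k = max ((V⁻¹ • Q t) k + V⁻¹ * conVec A b (x t) k) 0 := by
  simp only [PiLp.smul_apply, smul_eq_mul, h.queue, conVec_apply]
  rw [mul_max_of_nonneg _ _ (inv_nonneg.2 h.V_pos.le), mul_add, mul_zero]

end IsRun

/-- The projection inequality `⟪lam' - lam - c, lam' - nu⟫ ≤ 0`, coordinate by coordinate, inserted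
into the expansion of `‖lam - nu‖²` around `lam'`. -/
theorem norm_sq_projected_step_le {lam lam' nu c : E m} (hnu : nu ∈ orthant m)
    (h : ∀ k, lam' k = max (lam k + c k) 0) :
    ‖lam' - nu‖ ^ 2 ≤ ‖lam - nu‖ ^ 2 - ‖lam' - lam‖ ^ 2 + 2 * ⟪c, lam' - nu⟫ := by
  simp only [EuclideanSpace.real_norm_sq_eq, inner_eq_sum, Finset.mul_sum,
    ← Finset.sum_sub_distrib, ← Finset.sum_add_distrib, PiLp.sub_apply]
  refine Finset.sum_le_sum fun k _ => ?_
  rw [h k]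
  have h0 := hnu k
  rcases le_total 0 (lam k + c k) with hz | hz
  · rw [max_eq_left hz]; nlinarith
  · rw [max_eq_right hz]; nlinarith

/-- One step of the algorithm is an ascent step for the dual function. -/
theorem projected_step_dual {α B V : ℝ} {lam lam' lams : E m} {x : E n} (hα : 0 < α)
    (hc : StrongConvexOn univ α f) (hf : Differentiable ℝ f) (hV : 0 < V)
    (hB : ∀ v, ‖conMap A v‖ ^ 2 ≤ B * ‖v‖ ^ 2) (hBV : B ≤ V * α)
    (hx : IsDualMin f A b lam x) (hs : lams ∈ orthant m)
    (h : ∀ k, lam' k = max (lam k + V⁻¹ * conVec A b x k) 0) :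
    ‖lam' - lams‖ ^ 2 + 2 / V * (dual univ f (linCon A b) lams - dual univ f (linCon A b) lam') ≤
      ‖lam - lams‖ ^ 2 := by
  obtain ⟨x', hx'⟩ := exists_isDualMin (A := A) (b := b) hα hc hf lam'
  obtain ⟨y, hy⟩ := exists_isDualMin (A := A) (b := b) hα hc hf lams
  have h1 := norm_sq_projected_step_le (c := V⁻¹ • conVec A b x) hs h
  have h2 := hx.le_dual hx' hV hc hf hB hBV
  have h3 := hx.dual_le hy hc hf
  have h4 : 0 ≤ α / 2 * ‖x - y‖ ^ 2 := by positivity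
  rw [real_inner_smul_left] at h1
  have h5 : ⟪conVec A b x, lam' - lams⟫ =
      ⟪conVec A b x, lam' - lam⟫ - ⟪conVec A b x, lams - lam⟫ := by
    rw [← inner_sub_right]; congr 1; abel
  -- The quadratic lower bound is used from `lam` to `lam'`, the supergradient bound from `lam` to
  -- `lams`. After scaling by `2/V` the error is exactly the `‖lam' - lam‖²` gained by the
  -- projection.
  have h6 : ⟪conVec A b x, lam' - lams⟫ ≤ dual univ f (linCon A b) lam' -
      dual univ f (linCon A b) lams + V / 2 * ‖lam' - lam‖ ^ 2 := by linarith
  have h7 := mul_le_mul_of_nonneg_left h6 (inv_nonneg.2 hV.le)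
  have h8 : V⁻¹ * (dual univ f (linCon A b) lam' -
      dual univ f (linCon A b) lams + V / 2 * ‖lam' - lam‖ ^ 2) = -(1 / 2) * (2 / V *
      (dual univ f (linCon A b) lams - dual univ f (linCon A b) lam')) +
      ‖lam' - lam‖ ^ 2 / 2 := by
    field_simp; ring
  rw [h8] at h7
  linarith

theorem IsLagrangeMultiplier.dual_le {lams lam : E m} (hxs : IsOptimal univ f (linCon A b) xs)
    (hatt : DualAttained univ f (linCon A b))
    (h : IsLagrangeMultiplier univ f (linCon A b) lams) (hlam : lam ∈ orthant m) :
    dual univ f (linCon A b) lam ≤ dual univ f (linCon A b) lams := by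
  have h1 := (hatt lam hlam).2 (mem_image_of_mem _ (mem_univ xs))
  have h2 : ∑ k, lam k * linCon A b k xs ≤ 0 :=
    Finset.sum_nonpos fun k _ => mul_nonpos_of_nonneg_of_nonpos (hlam k) (hxs.1.2 k)
  rw [lagrangian] at h1
  rw [h.dual_eq hxs]
  linarith

/-- Outside the region of quadratic growth, the dual function is bounded away from its maximum. -/
theorem LocallyQuadraticDualAt.norm_sub_le {lams lam : E m} {D L α : ℝ}
    (h : LocallyQuadraticDualAt univ f (linCon A b) lams D L) (hα : 0 < α)
    (hc : StrongConvexOn univ α f) (hf : Differentiable ℝ f)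
    (hs : lams ∈ orthant m) (hlam : lam ∈ orthant m)
    (hmax : dual univ f (linCon A b) lam ≤ dual univ f (linCon A b) lams)
    (hlt : dual univ f (linCon A b) lams - dual univ f (linCon A b) lam < L * D ^ 2) :
    ‖lam - lams‖ ≤ D := by
  by_contra! hgt
  obtain ⟨hD, hL, hq⟩ := h
  have hr : 0 < ‖lam - lams‖ := hD.trans hgt
  -- `nu` is where the segment from `lams` to `lam` crosses the sphere of radius `D`. There the gap
  -- is at least `L D²`, while concavity bounds it by `s` times the gap at `lam`.
  set s := D / ‖lam - lams‖ with hs'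
  have hs0 : 0 ≤ s := by positivity
  have hs1 : s ≤ 1 := (div_le_one hr).2 hgt.le
  set nu := lams + s • (lam - lams) with hnu
  have e0 : nu - lams = s • (lam - lams) := by rw [hnu]; abel
  have e1 : lams - nu = (-s) • (lam - lams) := by rw [hnu]; module
  have e2 : lam - nu = (1 - s) • (lam - lams) := by rw [hnu]; module
  have hnorm : ‖nu - lams‖ = D := by
    rw [e0, norm_smul, Real.norm_eq_abs, abs_of_nonneg hs0, hs', div_mul_cancel₀ _ hr.ne']
  have hnuo : nu ∈ orthant m := fun k => by
    have h1 := hs k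
    have h2 := hlam k
    rw [hnu, PiLp.add_apply, PiLp.smul_apply, PiLp.sub_apply, smul_eq_mul]
    nlinarith
  have h1 := hq nu hnuo hnorm.le
  rw [hnorm] at h1
  obtain ⟨z, hz⟩ := exists_isDualMin (A := A) (b := b) hα hc hf nu
  obtain ⟨y, hy⟩ := exists_isDualMin (A := A) (b := b) hα hc hf lams
  obtain ⟨x, hx⟩ := exists_isDualMin (A := A) (b := b) hα hc hf lam
  have h2 := hz.dual_le hy hc hf
  have h3 := hz.dual_le hx hc hf
  have h4 : 0 ≤ α / 2 * ‖z - y‖ ^ 2 := by positivity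
  have h5 : 0 ≤ α / 2 * ‖z - x‖ ^ 2 := by positivity
  rw [e1, inner_smul_right] at h2
  rw [e2, inner_smul_right] at h3
  have h6 := mul_le_mul_of_nonneg_left (h2.trans' (le_add_of_nonneg_right h4))
    (sub_nonneg.2 hs1)
  have h7 := mul_le_mul_of_nonneg_left (h3.trans' (le_add_of_nonneg_right h5)) hs0
  nlinarith

theorem eventually_le_geometric {d : ℕ → ℝ} {ρ : ℝ} (hρ : 0 ≤ ρ)
    (h : ∀ᶠ t in atTop, d (t + 1) ≤ ρ * d t) : ∃ C, ∀ᶠ t in atTop, d t ≤ C * ρ ^ t := by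
  obtain ⟨T, hT⟩ := eventually_atTop.1 h
  have hk : ∀ j, d (T + j) ≤ ρ ^ j * d T := fun j => by
    induction j with
    | zero => simp
    | succ j ih =>
      calc d (T + j + 1) ≤ ρ * d (T + j) := hT _ (by omega)
        _ ≤ ρ * (ρ ^ j * d T) := by gcongr
        _ = ρ ^ (j + 1) * d T := by ring
  -- Starting at `T + 1` keeps `0 ^ 0` out of the case `ρ = 0`.
  refine ⟨d T / ρ ^ T, eventually_atTop.2 ⟨T + 1, fun t ht => ?_⟩⟩
  obtain ⟨j, rfl⟩ : ∃ j, t = T + j := ⟨t - T, by omega⟩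
  refine (hk j).trans (le_of_eq ?_)
  rcases hρ.eq_or_lt with h0 | h0
  · rw [← h0, zero_pow (show j ≠ 0 by omega), zero_pow (show T + j ≠ 0 by omega)]; simp
  · rw [pow_add]; field_simp

/-! ### Contraction of the scaled queues -/

section Convergence

variable {V : ℝ} {x : ℕ → E n} {Q : ℕ → E m} {xbar : ℕ → E n} {α B : ℝ} {lams : E m}

/-- The scaled queues eventually contract towards a multiplier at which the dual function is
locally quadratic. -/
theorem IsRun.eventually_contract (h : IsRun univ f (linCon A b) V x Q xbar)
    (hxs : IsOptimal univ f (linCon A b) xs) (hα : 0 < α) (hc : StrongConvexOn univ α f)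
    (hf : Differentiable ℝ f) (hB : ∀ v, ‖conMap A v‖ ^ 2 ≤ B * ‖v‖ ^ 2) (hBV : B ≤ V * α)
    (hl : IsLagrangeMultiplier univ f (linCon A b) lams) {D L : ℝ}
    (hq : LocallyQuadraticDualAt univ f (linCon A b) lams D L) :
    ∀ᶠ t in atTop, ‖V⁻¹ • Q (t + 1) - lams‖ ^ 2 ≤
      (1 + 2 * L / V)⁻¹ * ‖V⁻¹ • Q t - lams‖ ^ 2 := by
  have hV := h.V_pos
  have hatt := dualAttained (A := A) (b := b) hα hc hf
  have hstep : ∀ t, ‖V⁻¹ • Q (t + 1) - lams‖ ^ 2 + 2 / V * (dual univ f (linCon A b) lams -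
      dual univ f (linCon A b) (V⁻¹ • Q (t + 1))) ≤ ‖V⁻¹ • Q t - lams‖ ^ 2 := fun t =>
    projected_step_dual hα hc hf hV hB hBV (h.isDualMin t) hl.1 (h.smul_queue t)
  have hmax : ∀ t, dual univ f (linCon A b) (V⁻¹ • Q t) ≤ dual univ f (linCon A b) lams :=
    fun t => hl.dual_le hxs hatt (h.smul_mem_orthant t)
  have hanti : Antitone fun t => ‖V⁻¹ • Q t - lams‖ ^ 2 := antitone_nat_of_succ_le fun t => by
    have h1 := hstep t
    have h2 : 0 ≤ 2 / V * (dual univ f (linCon A b) lams -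
      dual univ f (linCon A b) (V⁻¹ • Q (t + 1))) :=
      mul_nonneg (by positivity) (sub_nonneg.2 (hmax _))
    linarith
  -- The squared distances decrease to a limit, so their successive differences, and with them the
  -- dual gaps, tend to `0`. Once a gap is below `L D²`, the queue lies in the region of quadratic
  -- growth.
  have hlim := tendsto_atTop_ciInf hanti ⟨0, by rintro _ ⟨t, rfl⟩; exact sq_nonneg _⟩
  have hdiff := hlim.sub (hlim.comp (tendsto_add_atTop_nat 1))
  rw [sub_self] at hdiff
  obtain ⟨hD, hL, hquad⟩ := id hq
  have hsmall := hdiff.eventually_lt_const (show 0 < 2 / V * (L * D ^ 2) by positivity)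
  filter_upwards [hsmall] with t ht
  have h1 := hstep t
  simp only [Function.comp_apply] at ht
  have h2 : dual univ f (linCon A b) lams - dual univ f (linCon A b) (V⁻¹ • Q (t + 1)) <
      L * D ^ 2 := by
    have : 2 / V * (dual univ f (linCon A b) lams -
        dual univ f (linCon A b) (V⁻¹ • Q (t + 1))) < 2 / V * (L * D ^ 2) := by linarith
    exact lt_of_mul_lt_mul_left this (by positivity)
  have h3 := hq.norm_sub_le hα hc hf hl.1 (h.smul_mem_orthant (t + 1)) (hmax _) h2
  have h4 := hquad _ (h.smul_mem_orthant (t + 1)) h3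
  have h5 : 2 / V * (L * ‖V⁻¹ • Q (t + 1) - lams‖ ^ 2) ≤ 2 / V * (dual univ f (linCon A b) lams -
      dual univ f (linCon A b) (V⁻¹ • Q (t + 1))) := by
    gcongr; linarith
  rw [inv_mul_eq_div, le_div_iff₀ (by positivity)]
  calc _ = ‖V⁻¹ • Q (t + 1) - lams‖ ^ 2 + 2 / V * (L * ‖V⁻¹ • Q (t + 1) - lams‖ ^ 2) := by ring
    _ ≤ _ := by linarith

/-- Strong concavity makes the gradient of the dual function strongly monotone. -/
theorem LocallyStronglyConcaveDualAt.sq_le_inner {D L : ℝ}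
    (h : LocallyStronglyConcaveDualAt univ f (linCon A b) lams D L) (hα : 0 < α)
    (hc : StrongConvexOn univ α f) (hf : Differentiable ℝ f) {lam mu : E m} {x y : E n}
    (hx : IsDualMin f A b lam x) (hy : IsDualMin f A b mu y)
    (hlam : lam ∈ orthant m) (hmu : mu ∈ orthant m) (hlamD : ‖lam - lams‖ ≤ D)
    (hmuD : ‖mu - lams‖ ≤ D) :
    L * ‖lam - mu‖ ^ 2 ≤ -⟪conVec A b x - conVec A b y, lam - mu⟫ := by
  have key : ∀ {lam mu : E m} {x : E n}, IsDualMin f A b lam x → lam ∈ orthant m →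
      mu ∈ orthant m → ‖lam - lams‖ ≤ D → ‖mu - lams‖ ≤ D →
      L / 2 * ‖lam - mu‖ ^ 2 ≤ dual univ f (linCon A b) lam - dual univ f (linCon A b) mu -
        ⟪conVec A b x, lam - mu⟫ := by
    intro lam mu x hx hlam hmu hlamD hmuD
    -- Compare strong concavity at `(1 - s) lam + s mu` with the supergradient bound at `lam`,
    -- divide by `s`, and let `s` tend to `0`.
    refine le_of_forall_one_sub_mul_le fun s hs0 hs1 => ?_
    have h1 := h.2.2.2 ⟨hlam, hlamD⟩ ⟨hmu, hmuD⟩ (sub_nonneg.2 hs1.le) hs0.le (by ring)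
    obtain ⟨z, hz⟩ := exists_isDualMin (A := A) (b := b) hα hc hf ((1 - s) • lam + s • mu)
    have h2 := hx.dual_le hz hc hf
    have h3 : 0 ≤ α / 2 * ‖x - z‖ ^ 2 := by positivity
    have e : (1 - s) • lam + s • mu - lam = (-s) • (lam - mu) := by module
    rw [e, inner_smul_right] at h2
    simp only [smul_eq_mul] at h1
    refine le_of_mul_le_mul_left ?_ hs0
    linarith
  have h1 := key hx hlam hmu hlamD hmuD
  have h2 := key hy hmu hlam hmuD hlamD
  rw [norm_sub_rev mu lam, ← neg_sub lam mu, inner_neg_right] at h2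
  rw [inner_sub_left]
  linarith

theorem norm_sq_max_sub_max_le {u v u' v' : E m} (hu : ∀ k, u' k = max (u k) 0)
    (hv : ∀ k, v' k = max (v k) 0) : ‖u' - v'‖ ^ 2 ≤ ‖u - v‖ ^ 2 := by
  simp only [EuclideanSpace.real_norm_sq_eq, PiLp.sub_apply]
  refine Finset.sum_le_sum fun k _ => ?_
  rw [hu, hv]
  exact sq_le_sq.2 (abs_max_sub_max_le_abs _ _ _)

/-- A modulus of strong concavity cannot exceed the smoothness constant `V`. Two distinct points of
the region are compared, which exist because `m > 0`. The bound makes `1 - L / V` a legitimate base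
for real powers. -/
theorem LocallyStronglyConcaveDualAt.le_of_norm_sq_le {D L : ℝ}
    (h : LocallyStronglyConcaveDualAt univ f (linCon A b) lams D L) (hm : 0 < m) (hα : 0 < α)
    (hc : StrongConvexOn univ α f) (hf : Differentiable ℝ f) (hV : 0 < V)
    (hB : ∀ v, ‖conMap A v‖ ^ 2 ≤ B * ‖v‖ ^ 2) (hBV : B ≤ V * α) (hs : lams ∈ orthant m) :
    L ≤ V := by
  have hD := h.1
  set lam : E m := lams + EuclideanSpace.single ⟨0, hm⟩ D with hlam
  have e : lam - lams = EuclideanSpace.single ⟨0, hm⟩ D := by rw [hlam, add_sub_cancel_left]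
  have hnorm : ‖lam - lams‖ = D := by
    rw [e, PiLp.norm_single, Real.norm_eq_abs, abs_of_pos hD]
  have hmem : lam ∈ orthant m := fun k => by
    rw [hlam, PiLp.add_apply, PiLp.single_apply]
    have := hs k
    split_ifs <;> linarith
  obtain ⟨x, hx⟩ := exists_isDualMin (A := A) (b := b) hα hc hf lam
  obtain ⟨y, hy⟩ := exists_isDualMin (A := A) (b := b) hα hc hf lams
  have h1 := h.sq_le_inner hα hc hf hx hy hmem hs hnorm.le (by simpa using hD.le)
  have h2 := hx.sq_le_inner hy hc hf
  rw [conVec_sub] at h1 h2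
  have h3 := abs_real_inner_le_norm (conMap A (x - y)) (lam - lams)
  have h4 := neg_abs_le ⟪conMap A (x - y), lam - lams⟫
  have h5 := hB (x - y)
  rw [hnorm] at h1 h3
  set p := ‖conMap A (x - y)‖
  set i := ⟪conMap A (x - y), lam - lams⟫
  have h6 : p ^ 2 ≤ V * (p * D) := by
    calc p ^ 2 ≤ V * α * ‖x - y‖ ^ 2 := h5.trans (by gcongr)
      _ = V * (α * ‖x - y‖ ^ 2) := by ring
      _ ≤ V * (p * D) := mul_le_mul_of_nonneg_left (by linarith) hV.le
  have h7 : p ≤ V * D := by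
    rcases (norm_nonneg _ : 0 ≤ p).eq_or_lt with h0 | h0
    · exact h0.symm.le.trans (by positivity)
    · exact le_of_mul_le_mul_left (by linarith [sq p]) h0
  have h8 : L * D ^ 2 ≤ V * D ^ 2 := by nlinarith
  exact le_of_mul_le_mul_right h8 (by positivity)

/-- The multiplier is a fixed point of the nonexpansive projected step, so the unprojected steps may
be compared. Half of the cross term absorbs the squared gradient difference, by cocoercivity; the
other half yields `L / V`, by strong monotonicity. The hypothesis `hlim` brings the queues into the
region of strong concavity. -/
theorem IsRun.eventually_contract_of_stronglyConcave
    (h : IsRun univ f (linCon A b) V x Q xbar)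
    (hxs : IsOptimal univ f (linCon A b) xs) (hα : 0 < α) (hc : StrongConvexOn univ α f)
    (hf : Differentiable ℝ f) (hB : ∀ v, ‖conMap A v‖ ^ 2 ≤ B * ‖v‖ ^ 2) (hBV : B ≤ V * α)
    (hl : IsLagrangeMultiplier univ f (linCon A b) lams) {D L : ℝ}
    (hq : LocallyStronglyConcaveDualAt univ f (linCon A b) lams D L)
    (hlim : Tendsto (fun t => ‖V⁻¹ • Q t - lams‖) atTop (𝓝 0)) :
    ∀ᶠ t in atTop, ‖V⁻¹ • Q (t + 1) - lams‖ ^ 2 ≤ (1 - L / V) * ‖V⁻¹ • Q t - lams‖ ^ 2 := by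
  have hV := h.V_pos
  have hatt := dualAttained (A := A) (b := b) hα hc hf
  have hs := hl.isDualMin hxs hatt
  -- Complementary slackness: either `lams k` vanishes and the step is nonpositive, or the step
  -- vanishes.
  have hfix : ∀ k, lams k = max ((lams + V⁻¹ • conVec A b xs) k) 0 := fun k => by
    rw [PiLp.add_apply, PiLp.smul_apply, smul_eq_mul, conVec_apply]
    rcases mul_eq_zero.1 (hl.mul_eq_zero hxs hatt k) with h0 | h0
    · rw [h0, zero_add, max_eq_right]
      exact mul_nonpos_of_nonneg_of_nonpos (inv_nonneg.2 hV.le) (hxs.1.2 k)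
    · rw [h0, mul_zero, add_zero, max_eq_left (hl.1 k)]
  filter_upwards [hlim.eventually_lt_const hq.1] with t ht
  set lam := V⁻¹ • Q t with hlam
  have h1 : ‖V⁻¹ • Q (t + 1) - lams‖ ^ 2 ≤
      ‖(lam + V⁻¹ • conVec A b (x t)) - (lams + V⁻¹ • conVec A b xs)‖ ^ 2 :=
    norm_sq_max_sub_max_le (h.smul_queue t) hfix
  have e : (lam + V⁻¹ • conVec A b (x t)) - (lams + V⁻¹ • conVec A b xs) =
      (lam - lams) + V⁻¹ • conMap A (x t - xs) := by
    rw [← conVec_sub (b := b)]; module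
  have h2 := hq.sq_le_inner hα hc hf (h.isDualMin t) hs (h.smul_mem_orthant t) hl.1 ht.le
    (by simpa using hq.1.le)
  have h3 := (h.isDualMin t).sq_le_inner hs hc hf
  rw [conVec_sub, real_inner_comm] at h2 h3
  rw [e, norm_add_sq_real, inner_smul_right, norm_smul, Real.norm_eq_abs,
    abs_of_pos (inv_pos.2 hV), mul_pow] at h1
  have h4 : ‖conMap A (x t - xs)‖ ^ 2 ≤ V * (-⟪lam - lams, conMap A (x t - xs)⟫) := by
    calc ‖conMap A (x t - xs)‖ ^ 2 ≤ V * α * ‖x t - xs‖ ^ 2 := (hB _).trans (by gcongr)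
      _ = V * (α * ‖x t - xs‖ ^ 2) := by ring
      _ ≤ _ := by gcongr
  have h5 : V⁻¹ ^ 2 * ‖conMap A (x t - xs)‖ ^ 2 ≤
      V⁻¹ * (-⟪lam - lams, conMap A (x t - xs)⟫) := by
    calc _ ≤ V⁻¹ ^ 2 * (V * (-⟪lam - lams, conMap A (x t - xs)⟫)) := by gcongr
      _ = _ := by field_simp
  have h6 := mul_le_mul_of_nonneg_left h2 (inv_nonneg.2 hV.le)
  calc _ ≤ _ := h1
    _ ≤ ‖lam - lams‖ ^ 2 - V⁻¹ * (L * ‖lam - lams‖ ^ 2) := by linarith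
    _ = _ := by ring

end Convergence

/-! ### Rates of convergence -/

/-- Both `f` and the constraints are Lipschitz near `xs`, and `r → 0` brings `y t` there. -/
theorem errorDecaysLike_of_norm_sub_le (hf : ContDiff ℝ 2 f)
    (hxs : IsOptimal univ f (linCon A b) xs) {y : ℕ → E n} {r : ℕ → ℝ} {C : ℝ}
    (hr : Tendsto r atTop (𝓝 0)) (hr0 : ∀ t, 0 ≤ r t)
    (h : ∀ᶠ t in atTop, ‖y t - xs‖ ≤ C * r t) : ErrorDecaysLike f (linCon A b) xs y r := by
  obtain ⟨K, hK, δ, hδ, hlip⟩ := exists_lipschitz_ball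
    ((hf.of_le one_le_two).contDiffAt (x := xs))
  have hCr : Tendsto (fun t => C * r t) atTop (𝓝 0) := by simpa using hr.const_mul C
  refine ⟨(K + ‖conMap A‖) * |C| + 1, by positivity, ?_⟩
  filter_upwards [h, hCr.eventually_lt_const hδ] with t ht hlt
  have hle : ‖y t - xs‖ ≤ |C| * r t :=
    ht.trans (mul_le_mul_of_nonneg_right (le_abs_self C) (hr0 t))
  have hCr0 : 0 ≤ |C| * r t := mul_nonneg (abs_nonneg C) (hr0 t)
  have hf1 := (le_abs_self _).trans (hlip (y t) xs (ht.trans_lt hlt) (by simpa using hδ))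
  have hf2 := mul_le_mul_of_nonneg_left hle hK
  have hA0 := mul_nonneg (norm_nonneg (conMap A)) hCr0
  refine ⟨by nlinarith [hr0 t], fun k => ?_⟩
  have h1 := (le_abs_self _).trans ((abs_apply_le_norm _ k).trans ((conMap A).le_opNorm (y t - xs)))
  rw [← linCon_sub (b := b)] at h1
  have h2 := mul_le_mul_of_nonneg_left hle (norm_nonneg (conMap A))
  have h3 := hxs.1.2 k
  have h4 := mul_nonneg hK hCr0
  nlinarith [hr0 t]

theorem ErrorDecaysLike.mono {g : Fin m → E n → ℝ} {y : ℕ → E n} {r r' : ℕ → ℝ}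
    (h : ErrorDecaysLike f g xs y r) (hr : ∀ᶠ t in atTop, r t ≤ r' t) :
    ErrorDecaysLike f g xs y r' := by
  obtain ⟨C, hC, h⟩ := h
  refine ⟨C, hC, ?_⟩
  filter_upwards [h, hr] with t ht hrt
  have : C * r t ≤ C * r' t := by gcongr
  exact ⟨by linarith [ht.1], fun k => (ht.2 k).trans this⟩

theorem HasConvergenceTime.mono {X : Set (E n)} {g : Fin m → E n → ℝ} {y : ℕ → E n}
    {h h' : ℝ → ℝ} (H : HasConvergenceTime X f g xs y h) {c : ℝ} (hc : 0 < c)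
    (hh : ∀ᶠ ε in 𝓝[>] 0, h ε ≤ c * h' ε) : HasConvergenceTime X f g xs y h' := by
  obtain ⟨C, hC, H⟩ := H
  refine ⟨C * c, by positivity, ?_⟩
  filter_upwards [H, hh] with ε hε hle t ht
  refine hε t (le_trans ?_ ht)
  rw [mul_assoc]
  gcongr

theorem tendsto_log_one_div : Tendsto (fun ε : ℝ => Real.log (1 / ε)) (𝓝[>] 0) atTop := by
  simp only [one_div, Real.log_inv]
  exact tendsto_neg_atBot_atTop.comp Real.tendsto_log_nhdsGT_zero

/-- Geometric decay of the errors gives a logarithmic convergence time. -/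
theorem ErrorDecaysLike.hasConvergenceTime_log {g : Fin m → E n → ℝ} {y : ℕ → E n} {w : ℝ}
    (h : ErrorDecaysLike f g xs y fun t => w ^ t) (hw0 : 0 < w) (hw : w < 1) :
    HasConvergenceTime univ f g xs y fun ε => Real.log (1 / ε) := by
  obtain ⟨C, hC, h⟩ := h
  obtain ⟨T, hT⟩ := eventually_atTop.1 h
  have hlog : 0 < -Real.log w := neg_pos.2 (Real.log_neg hw0 hw)
  have hC2 : 0 < 2 / -Real.log w := by positivity
  -- The factor `2` yields `w ^ t ≤ ε²`; the spare `ε` absorbs `C` once `ε < 1 / C`.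
  refine ⟨2 / -Real.log w, hC2, ?_⟩
  filter_upwards [(tendsto_log_one_div.const_mul_atTop hC2).eventually_ge_atTop (T : ℝ),
    Ioo_mem_nhdsGT (inv_pos.2 hC), self_mem_nhdsWithin] with ε hεT hεC hε0 t ht
  have hε0 : 0 < ε := hε0
  obtain ⟨h1, h2⟩ := hT t (by exact_mod_cast hεT.trans ht)
  have h3 : w ^ t ≤ ε ^ 2 := by
    rw [← Real.log_le_log_iff (by positivity) (by positivity), Real.log_pow, Real.log_pow]
    rw [div_mul_eq_mul_div, div_le_iff₀ hlog, one_div, Real.log_inv] at ht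
    push_cast
    linarith
  have h4 : C * w ^ t ≤ ε := by
    have h5 : C * ε ≤ 1 := by
      have := mul_le_mul_of_nonneg_left hεC.2.le hC.le
      rwa [mul_inv_cancel₀ hC.ne'] at this
    calc C * w ^ t ≤ C * ε ^ 2 := by gcongr
      _ = C * ε * ε := by ring
      _ ≤ 1 * ε := by gcongr
      _ = ε := one_mul ε
  exact ⟨mem_univ _, by linarith, fun k => (h2 k).trans h4⟩

theorem log_one_div_le_rpow : ∀ᶠ ε : ℝ in 𝓝[>] 0,
    Real.log (1 / ε) ≤ 3 / 2 * (1 / ε ^ (2 / 3 : ℝ)) := by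
  filter_upwards [self_mem_nhdsWithin] with ε hε
  have hε : 0 < ε := hε
  have h := Real.log_le_rpow_div (x := 1 / ε) (ε := 2 / 3) (by positivity) (by norm_num)
  rw [Real.div_rpow zero_le_one hε.le, Real.one_rpow] at h
  linarith

theorem eventually_pow_le_one_div {w : ℝ} (hw0 : 0 ≤ w) (hw : w < 1) :
    ∀ᶠ t : ℕ in atTop, w ^ t ≤ 1 / (t : ℝ) := by
  filter_upwards [(tendsto_self_mul_const_pow_of_lt_one hw0 hw).eventually_lt_const one_pos,
    eventually_gt_atTop 0] with t ht ht0
  rw [le_div_iff₀ (by exact_mod_cast ht0), mul_comm]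
  exact ht.le

theorem eventually_one_div_mul_pow_le {w : ℝ} (hw0 : 0 ≤ w) (hw : w < 1) :
    ∀ᶠ t : ℕ in atTop, 1 / (t : ℝ) * w ^ t ≤ 1 / (t : ℝ) ^ (3 / 2 : ℝ) := by
  filter_upwards [eventually_pow_le_one_div hw0 hw, eventually_ge_atTop 1] with t ht ht0
  have ht1 : (1 : ℝ) ≤ t := by exact_mod_cast ht0
  calc 1 / (t : ℝ) * w ^ t ≤ 1 / (t : ℝ) * (1 / t) := by gcongr
    _ = 1 / (t : ℝ) ^ (2 : ℝ) := by rw [Real.rpow_two]; ring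
    _ ≤ 1 / (t : ℝ) ^ (3 / 2 : ℝ) :=
      one_div_le_one_div_of_le (by positivity) (Real.rpow_le_rpow_of_exponent_le ht1 (by norm_num))

theorem one_div_mul_pow_le_pow {w : ℝ} (hw0 : 0 ≤ w) {t : ℕ} (ht : 1 ≤ t) :
    1 / (t : ℝ) * w ^ t ≤ w ^ t := by
  have ht1 : (1 : ℝ) ≤ t := by exact_mod_cast ht
  exact mul_le_of_le_one_left (by positivity) ((div_le_one (by linarith)).2 ht1)

theorem tendsto_one_div_mul_pow {w : ℝ} (hw0 : 0 ≤ w) (hw : w < 1) :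
    Tendsto (fun t : ℕ => 1 / (t : ℝ) * w ^ t) atTop (𝓝 0) := by
  simpa using tendsto_one_div_atTop_nhds_zero_nat.mul
    (tendsto_pow_atTop_nhds_zero_of_lt_one hw0 hw)

/-! ### Shifted running averages and the resulting rates -/

section Averages

variable {V : ℝ} {x : ℕ → E n} {Q : ℕ → E m} {xbar : ℕ → E n} {C w : ℝ}

/-- The average is over `p` errors starting at index `p`, so their sum is bounded by a geometric
tail in `w ^ 2`. -/
theorem IsRun.norm_avg_even_sub_le {g : Fin m → E n → ℝ} (h : IsRun univ f g V x Q xbar)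
    (hC : 0 ≤ C) (hw0 : 0 ≤ w) (hw : w < 1) {p : ℕ} (hp : 1 ≤ p)
    (hx : ∀ τ, p ≤ τ → ‖x τ - xs‖ ≤ C * w ^ (2 * τ)) :
    ‖xbar (2 * p) - xs‖ ≤ (p : ℝ)⁻¹ * (C / (1 - w ^ 2) * w ^ (2 * p)) := by
  have hp0 : (0 : ℝ) < p := by exact_mod_cast hp
  have h1 := h.avg_even (2 * p - 1) ⟨p, by omega⟩
  have e1 : 2 * p - 1 + 1 = 2 * p := by omega
  have e2 : ((2 * p : ℕ) : ℝ) / 2 = p := by push_cast; ring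
  rw [e1, e2, Nat.mul_div_cancel_left p two_pos] at h1
  have e3 : xbar (2 * p) - xs = (p : ℝ)⁻¹ • ∑ τ ∈ Finset.Icc p (2 * p - 1), (x τ - xs) := by
    rw [Finset.sum_sub_distrib, Finset.sum_const, Nat.card_Icc, e1, smul_sub, ← h1,
      show 2 * p - p = p by omega, ← Nat.cast_smul_eq_nsmul ℝ, smul_smul,
      inv_mul_cancel₀ hp0.ne', one_smul]
  rw [e3, norm_smul, Real.norm_eq_abs, abs_of_pos (inv_pos.2 hp0)]
  gcongr
  have hw2 : w ^ 2 < 1 := pow_lt_one₀ hw0 hw two_ne_zero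
  calc ‖∑ τ ∈ Finset.Icc p (2 * p - 1), (x τ - xs)‖
      ≤ ∑ τ ∈ Finset.Icc p (2 * p - 1), C * (w ^ 2) ^ τ := by
        refine norm_sum_le_of_le _ fun τ hτ => ?_
        rw [← pow_mul]
        exact hx τ (Finset.mem_Icc.1 hτ).1
    _ = C * ∑ τ ∈ Finset.Ico p (2 * p), (w ^ 2) ^ τ := by
        rw [← Finset.mul_sum]
        congr 2
        ext τ; simp only [Finset.mem_Icc, Finset.mem_Ico]; omega
    _ ≤ C * ((w ^ 2) ^ p / (1 - w ^ 2)) := by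
        gcongr; exact geom_sum_Ico_le_of_lt_one (by positivity) hw2
    _ = C / (1 - w ^ 2) * w ^ (2 * p) := by rw [pow_mul]; ring

theorem IsRun.exists_norm_avg_sub_le {g : Fin m → E n → ℝ} (h : IsRun univ f g V x Q xbar)
    (hC : 0 ≤ C) (hw0 : 0 ≤ w) (hw : w < 1) (hx : ∀ᶠ t in atTop, ‖x t - xs‖ ≤ C * w ^ (2 * t)) :
    ∃ C', ∀ᶠ t : ℕ in atTop, ‖xbar t - xs‖ ≤ C' * (1 / (t : ℝ) * w ^ t) := by
  obtain ⟨T, hT⟩ := eventually_atTop.1 hx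
  have hw2 : 0 < 1 - w ^ 2 := sub_pos.2 (pow_lt_one₀ hw0 hw two_ne_zero)
  -- The `3` comes from `t ≤ 3 p`. The `w⁻¹` pays for odd `t`, whose average belongs to `t - 1`, and
  -- the `1` for even `t`.
  refine ⟨3 * (C / (1 - w ^ 2)) * (w⁻¹ + 1), eventually_atTop.2 ⟨2 * T + 2, fun t ht => ?_⟩⟩
  obtain ⟨p, hp⟩ : ∃ p, p = t / 2 := ⟨_, rfl⟩
  have hp1 : 1 ≤ p := by omega
  have hp0 : (0 : ℝ) < p := by exact_mod_cast hp1
  have ht0 : (0 : ℝ) < t := by exact_mod_cast (by omega : 0 < t)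
  have h1 := h.norm_avg_even_sub_le hC hw0 hw hp1 fun τ hτ => hT τ (by omega)
  have hcase : t = 2 * p ∨ t = 2 * p + 1 := by omega
  have hxbar : xbar t = xbar (2 * p) := by
    rcases hcase with e | e
    · rw [e]
    · rw [e]; exact h.avg_odd (2 * p) ⟨p, rfl⟩
  have hinv : (p : ℝ)⁻¹ ≤ 3 * (1 / t) := by
    have : (t : ℝ) ≤ 3 * p := by exact_mod_cast (by omega : t ≤ 3 * p)
    rw [← one_div, mul_one_div, div_le_div_iff₀ hp0 ht0]
    linarith
  have hpow : w ^ (2 * p) ≤ (w⁻¹ + 1) * w ^ t := by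
    have hi : 0 ≤ w⁻¹ := inv_nonneg.2 hw0
    have hwt : 0 ≤ w ^ t := by positivity
    rcases hcase with e | e
    · rw [← e]; nlinarith
    · rcases hw0.eq_or_lt with h0 | h0
      · rw [← h0, zero_pow (by omega)]; positivity
      · have : w⁻¹ * w ^ t = w ^ (2 * p) := by
          rw [e, pow_succ]; field_simp
        rw [add_mul, this]; linarith
  rw [hxbar]
  calc _ ≤ _ := h1
    _ ≤ 3 * (1 / t) * (C / (1 - w ^ 2) * ((w⁻¹ + 1) * w ^ t)) := by gcongr
    _ = _ := by ring

/-- Rates of the iterates and of their averages from geometric decay of the scaled queues. -/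
theorem IsRun.rates (h : IsRun univ f (linCon A b) V x Q xbar) {α : ℝ} (hα : 0 < α)
    (hc : StrongConvexOn univ α f) (hf : ContDiff ℝ 2 f)
    (hxs : IsOptimal univ f (linCon A b) xs) {lams : E m} (hs : IsDualMin f A b lams xs)
    (hw0 : 0 ≤ w) (hw : w < 1)
    (hcontr : ∀ᶠ t in atTop, ‖V⁻¹ • Q (t + 1) - lams‖ ^ 2 ≤ w ^ 4 * ‖V⁻¹ • Q t - lams‖ ^ 2) :
    ErrorDecaysLike f (linCon A b) xs x (fun t => 1 / (t : ℝ) * w ^ t) ∧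
    ErrorDecaysLike f (linCon A b) xs xbar (fun t => 1 / (t : ℝ) * w ^ t) ∧
    Tendsto (fun t => ‖V⁻¹ • Q t - lams‖) atTop (𝓝 0) := by
  have hd : Differentiable ℝ f := hf.differentiable two_ne_zero
  obtain ⟨C, hC⟩ := eventually_le_geometric (d := fun t => ‖V⁻¹ • Q t - lams‖ ^ 2)
    (pow_nonneg hw0 4) hcontr
  -- The fourth power is chosen so that the square root leaves `w ^ (2 * t)` and averaging from `t /
  -- 2` leaves `w ^ t`.
  have hlam : ∀ᶠ t in atTop, ‖V⁻¹ • Q t - lams‖ ≤ √|C| * w ^ (2 * t) := by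
    filter_upwards [hC] with t ht
    refine abs_le_of_sq_le_sq' ?_ (by positivity) |>.2
    rw [mul_pow, Real.sq_sqrt (abs_nonneg C), ← pow_mul, show 2 * t * 2 = 4 * t by ring, pow_mul]
    exact ht.trans (mul_le_mul_of_nonneg_right (le_abs_self C) (by positivity))
  have hx : ∀ᶠ t in atTop, ‖x t - xs‖ ≤ ‖conMap A‖ / α * √|C| * w ^ (2 * t) := by
    filter_upwards [hlam] with t ht
    have h1 := (h.isDualMin t).norm_sub_le hs hα hc hd
    refine h1.trans ?_
    rw [mul_assoc]
    gcongr
  have hr0 : ∀ t : ℕ, 0 ≤ 1 / (t : ℝ) * w ^ t := fun t => by positivity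
  have hr := tendsto_one_div_mul_pow hw0 hw
  obtain ⟨C', hC'⟩ := h.exists_norm_avg_sub_le (by positivity) hw0 hw hx
  refine ⟨errorDecaysLike_of_norm_sub_le hf hxs (C := ‖conMap A‖ / α * √|C|) hr hr0 ?_,
    errorDecaysLike_of_norm_sub_le hf hxs hr hr0 hC', ?_⟩
  -- For the iterates, one of the two factors `w ^ t` is traded for `1 / t`.
  · filter_upwards [hx, eventually_pow_le_one_div hw0 hw] with t ht hp
    refine ht.trans ?_
    rw [two_mul, pow_add]
    gcongr
  · refine squeeze_zero' (Eventually.of_forall fun t => norm_nonneg _) hlam ?_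
    simp only [pow_mul]
    simpa using (tendsto_pow_atTop_nhds_zero_of_lt_one (by positivity)
      (pow_lt_one₀ hw0 hw two_ne_zero)).const_mul (√|C|)

/-- Geometric convergence when the active rows are independent. -/
theorem IsRun.exists_geometric_rate (h : IsRun univ f (linCon A b) V x Q xbar) {α B : ℝ}
    (hα : 0 < α) (hc : StrongConvexOn univ α f) (hf : ContDiff ℝ 2 f)
    (hxs : IsOptimal univ f (linCon A b) xs)
    (hB : ∀ v, ‖conMap A v‖ ^ 2 ≤ B * ‖v‖ ^ 2) (hBV : B ≤ V * α)
    {lams : E m} (hl : IsLagrangeMultiplier univ f (linCon A b) lams) {D L : ℝ}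
    (hq : LocallyQuadraticDualAt univ f (linCon A b) lams D L) :
    ∃ w, 0 < w ∧ w < 1 ∧
    ErrorDecaysLike f (linCon A b) xs x (fun t => 1 / (t : ℝ) * w ^ t) ∧
    ErrorDecaysLike f (linCon A b) xs xbar (fun t => 1 / (t : ℝ) * w ^ t) ∧
    Tendsto (fun t => ‖V⁻¹ • Q t - lams‖) atTop (𝓝 0) := by
  have hd : Differentiable ℝ f := hf.differentiable two_ne_zero
  have hV := h.V_pos
  have hL := hq.2.1
  have hρ0 : 0 < (1 + 2 * L / V)⁻¹ := by positivity
  have hρ1 : (1 + 2 * L / V)⁻¹ < 1 := inv_lt_one_of_one_lt₀ (lt_add_of_pos_right _ (by positivity))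
  have hw4 : ((1 + 2 * L / V)⁻¹ ^ (1 / 4 : ℝ)) ^ 4 = (1 + 2 * L / V)⁻¹ := by
    rw [← Real.rpow_natCast, ← Real.rpow_mul hρ0.le]; norm_num
  have hw0 : 0 < (1 + 2 * L / V)⁻¹ ^ (1 / 4 : ℝ) := Real.rpow_pos_of_pos hρ0 _
  have hw1 : (1 + 2 * L / V)⁻¹ ^ (1 / 4 : ℝ) < 1 := Real.rpow_lt_one hρ0.le hρ1 (by norm_num)
  refine ⟨_, hw0, hw1, h.rates hα hc hf hxs
    (hl.isDualMin hxs (dualAttained hα hc hd)) hw0.le hw1 ?_⟩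
  rw [hw4]
  exact h.eventually_contract hxs hα hc hd hB hBV hl hq

theorem ErrorDecaysLike.hasConvergenceTime_log_of_one_div_mul {g : Fin m → E n → ℝ} {y : ℕ → E n}
    (h : ErrorDecaysLike f g xs y fun t => 1 / (t : ℝ) * w ^ t) (hw0 : 0 < w) (hw : w < 1) :
    HasConvergenceTime univ f g xs y fun ε => Real.log (1 / ε) :=
  (h.mono ((eventually_ge_atTop 1).mono fun _ ht =>
    one_div_mul_pow_le_pow hw0.le ht)).hasConvergenceTime_log hw0 hw

end Averages

end DPP

/-! ### The main theorem -/

theorem mainTheorem7 {m n : ℕ} (hm : 0 < m)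
    (f : DPP.E n → ℝ) (A : Matrix (Fin m) (Fin n) ℝ) (b : Fin m → ℝ)
    (hf : ContDiff ℝ 2 f) (hfc : ∃ α : ℝ, 0 < α ∧ StrongConvexOn Set.univ α f)
    (xs : DPP.E n) (hxs : DPP.IsOptimal Set.univ f (DPP.linCon A b) xs) :
    -- the dual function is well defined and the algorithm can be executed
    DPP.DualAttained Set.univ f (DPP.linCon A b) ∧
    DPP.RunsExist Set.univ f (DPP.linCon A b) ∧
    -- part 1: the active submatrix has full row rank
    ((DPP.activeSubmatrix A b xs).rank = Nat.card (DPP.activeSet A b xs) →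
      (∃ α β, DPP.StronglyConvexProblem Set.univ f (DPP.linCon A b) α β) ∧
      DPP.StrongDuality Set.univ f (DPP.linCon A b) ∧
      (∃ γ, DPP.SmoothDual Set.univ f (DPP.linCon A b) γ) ∧
      (∀ lams, DPP.IsLagrangeMultiplier Set.univ f (DPP.linCon A b) lams →
        ∃ D L, DPP.LocallyQuadraticDualAt Set.univ f (DPP.linCon A b) lams D L) ∧
      ∀ α β γ V : ℝ, DPP.StronglyConvexProblem Set.univ f (DPP.linCon A b) α β →
        DPP.SmoothDual Set.univ f (DPP.linCon A b) γ →
        max (m * β ^ 2 / α) γ ≤ V →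
        ∀ x Q xbar, DPP.IsRun Set.univ f (DPP.linCon A b) V x Q xbar →
          DPP.ErrorDecaysLike f (DPP.linCon A b) xs xbar
            (fun t => 1 / (t : ℝ) ^ (3 / 2 : ℝ)) ∧
          DPP.HasConvergenceTime Set.univ f (DPP.linCon A b) xs xbar
            (fun ε => 1 / ε ^ (2 / 3 : ℝ))) ∧
    -- part 2: `A` has full row rank
    (A.rank = m →
      (∃ α β, DPP.StronglyConvexProblem Set.univ f (DPP.linCon A b) α β) ∧
      DPP.StrongDuality Set.univ f (DPP.linCon A b) ∧
      (∃ γ, DPP.SmoothDual Set.univ f (DPP.linCon A b) γ) ∧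
      (∀ lams, DPP.IsLagrangeMultiplier Set.univ f (DPP.linCon A b) lams →
        ∃ D L, DPP.LocallyStronglyConcaveDualAt Set.univ f (DPP.linCon A b) lams D L) ∧
      ∀ α β γ V : ℝ, DPP.StronglyConvexProblem Set.univ f (DPP.linCon A b) α β →
        DPP.SmoothDual Set.univ f (DPP.linCon A b) γ →
        max (m * β ^ 2 / α) γ ≤ V →
        ∀ x Q xbar, DPP.IsRun Set.univ f (DPP.linCon A b) V x Q xbar →
          -- the iterates themselves (no running averages) and their shifted running averages
          (∀ lams D L, DPP.IsLagrangeMultiplier Set.univ f (DPP.linCon A b) lams →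
            DPP.LocallyStronglyConcaveDualAt Set.univ f (DPP.linCon A b) lams D L →
            DPP.ErrorDecaysLike f (DPP.linCon A b) xs x
              (fun t => 1 / (t : ℝ) * (1 - L / V) ^ ((t : ℝ) / 4)) ∧
            DPP.ErrorDecaysLike f (DPP.linCon A b) xs xbar
              (fun t => 1 / (t : ℝ) * (1 - L / V) ^ ((t : ℝ) / 4))) ∧
          DPP.HasConvergenceTime Set.univ f (DPP.linCon A b) xs x
            (fun ε => Real.log (1 / ε)) ∧
          DPP.HasConvergenceTime Set.univ f (DPP.linCon A b) xs xbar
            (fun ε => Real.log (1 / ε))) := by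
  have hd : Differentiable ℝ f := hf.differentiable two_ne_zero
  obtain ⟨α₀, hα₀, hc₀⟩ := id hfc
  have hatt := DPP.dualAttained (A := A) (b := b) hα₀ hc₀ hd
  have hBV : ∀ {α β γ V : ℝ}, DPP.StronglyConvexProblem Set.univ f (DPP.linCon A b) α β →
      max (m * β ^ 2 / α) γ ≤ V → m * β ^ 2 ≤ V * α := fun hP hV =>
    (div_le_iff₀ hP.1).1 ((le_max_left _ _).trans hV)
  refine ⟨hatt, DPP.runsExist hα₀ hc₀ hd, fun hrank => ?_, fun hrank => ?_⟩
  · obtain ⟨R, hR⟩ := DPP.exists_isRowInverse_active hrank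
    have hdual := DPP.strongDuality_of_isRowInverse hxs hα₀ hc₀ hd hR
    refine ⟨DPP.exists_stronglyConvexProblem hfc, hdual, DPP.exists_smoothDual hα₀ hc₀ hd,
      fun lams hl => DPP.exists_locallyQuadraticDualAt hxs hα₀ hc₀ hf hl hR, ?_⟩
    intro α β γ V hP _ hV x Q xbar hrun
    obtain ⟨lams, hl⟩ := hdual
    obtain ⟨D, L, hq⟩ := DPP.exists_locallyQuadraticDualAt hxs hα₀ hc₀ hf hl hR
    obtain ⟨w, hw0, hw1, -, hbar, -⟩ := hrun.exists_geometric_rate hP.1 hP.2.1 hf hxs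
      hP.norm_sq_conMap_le (hBV hP hV) hl hq
    exact ⟨hbar.mono (DPP.eventually_one_div_mul_pow_le hw0.le hw1),
      (hbar.hasConvergenceTime_log_of_one_div_mul hw0 hw1).mono (by norm_num)
        DPP.log_one_div_le_rpow⟩
  · obtain ⟨R, hR⟩ := DPP.exists_isRowInverse_univ hrank
    have hR' : DPP.IsRowInverse A (DPP.activeSet A b xs) R := hR.mono (Set.subset_univ _)
    have hdual := DPP.strongDuality_of_isRowInverse hxs hα₀ hc₀ hd hR'
    refine ⟨DPP.exists_stronglyConvexProblem hfc, hdual, DPP.exists_smoothDual hα₀ hc₀ hd,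
      fun lams hl => DPP.exists_locallyStronglyConcaveDualAt hα₀ hc₀ hf
        (hl.isDualMin hxs hatt) hR, ?_⟩
    intro α β γ V hP _ hV x Q xbar hrun
    -- Independence of all rows gives that of the active ones, so quadratic growth already forces
    -- the queues to converge; a given radius `D` of strong concavity is then eventually reached.
    have hgeom : ∀ lams, DPP.IsLagrangeMultiplier Set.univ f (DPP.linCon A b) lams → _ :=
      fun lams hl =>
        let ⟨D, L, hq⟩ := DPP.exists_locallyQuadraticDualAt hxs hα₀ hc₀ hf hl hR'
        hrun.exists_geometric_rate hP.1 hP.2.1 hf hxs hP.norm_sq_conMap_le (hBV hP hV) hl hq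
    refine ⟨fun lams D L hl hq => ?_, ?_⟩
    · obtain ⟨-, -, -, -, -, hlim⟩ := hgeom lams hl
      have hVpos := hrun.V_pos
      have hLV : L ≤ V := hq.le_of_norm_sq_le hm hP.1 hP.2.1 hd hVpos hP.norm_sq_conMap_le
        (hBV hP hV) hl.1
      have hρ0 : 0 ≤ 1 - L / V := sub_nonneg.2 ((div_le_one hVpos).2 hLV)
      have hρ1 : 1 - L / V < 1 := sub_lt_self _ (div_pos hq.2.1 hVpos)
      have hpow : ∀ t : ℕ, (1 - L / V) ^ ((t : ℝ) / 4) = ((1 - L / V) ^ (1 / 4 : ℝ)) ^ t :=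
        fun t => by
          rw [← Real.rpow_natCast, ← Real.rpow_mul hρ0]; congr 1; ring
      have hw4 : ((1 - L / V) ^ (1 / 4 : ℝ)) ^ 4 = 1 - L / V := by
        rw [← hpow]; norm_num
      have hcontr := hrun.eventually_contract_of_stronglyConcave hxs hP.1 hP.2.1 hd
        hP.norm_sq_conMap_le (hBV hP hV) hl hq hlim
      rw [← hw4] at hcontr
      simp only [hpow]
      have hr := hrun.rates hP.1 hP.2.1 hf hxs (hl.isDualMin hxs hatt)
        (Real.rpow_nonneg hρ0 _) (Real.rpow_lt_one hρ0 hρ1 (by norm_num)) hcontr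
      exact ⟨hr.1, hr.2.1⟩
    · obtain ⟨lams, hl⟩ := hdual
      obtain ⟨w, hw0, hw1, hx, hbar, -⟩ := hgeom lams hl
      exact ⟨hx.hasConvergenceTime_log_of_one_div_mul hw0 hw1,
        hbar.hasConvergenceTime_log_of_one_div_mul hw0 hw1⟩
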